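/- Let $T>0$, $m\ge 1$, let $\alpha_0>\alpha_1>\dots>\alpha_m\ge 0$ be real numbers, and let $n_i\ge 0$ be the integers with $n_i-1<\alpha_i\le n_i$. For $\alpha>0$ let $I_{0+}^{\alpha}f(t)=\frac1{\Gamma(\alpha)}\int_0^t(t-\tau)^{\alpha-1}f(\tau)\,d\tau$, and let $I_{0+}^0f=f$. For $n-1<\alpha\le n$ ($n$ a nonnegative integer, $\alpha\ge0$) let $D_{0+}^{\alpha}f=\frac{d^n}{dt^n}I_{0+}^{n-\alpha}f$ be the Riemann–Liouville derivative and ${}^cD_{0+}^{\alpha}f=D_{0+}^{\alpha}\bigl[f-\sum_{k=0}^{n-1}\frac{f^{(k)}(0)}{k!}t^k\bigr]$ the Caputo derivative. For $0\le\gamma<1$, $C_\gamma[0,T]$ is the space of functions $f$ on $(0,T]$ for which $t^\gamma f(t)$ extends to a continuous function on $[0,T]$, and for $n\ge1$, $C^n_\gamma[0,T]$ is the space of functions that are $n-1$ times continuously differentiable on $[0,T]$ and have an $n$-th derivative $f^{(n)}\in C_\gamma[0,T]$, with norm $\sum_{k<n}\sup_{[0,T]}|f^{(k)}|+\sup_{(0,T]}|t^\gamma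 f^{(n)}(t)|$. Let $\Phi_\beta(t)=t^{\beta-1}/\Gamma(\beta)$, so $\Phi_{k+1}(t)=t^k/k!$. Let $H_j=\{i\in\{1,\dots,m\}:0\le\alpha_i\le j\}$ and, if $H_j\ne\emptyset$, $h_j=\min H_j$. Consider the equation $$ {}^cD_{0+}^{\alpha_0}y(t)=-\sum_{i=1}^m a_i(t)\,{}^cD_{0+}^{\alpha_i}y(t),\qquad 0<t<T. \tag{1}$$ A canonical fundamental system of (1) is a system of solutions $y_0,\dots,y_{n_0-1}$ of (1) with $y_j^{(k)}(0+)=\delta_{jk}$ for $j,k=0,\dots,n_0-1$. Assume $0<\gamma:=n_0-\alpha_0<1$, $n_0=n_1$, and, for $i=1,\dots,m$, $a_i\in C^1_\gamma[0,T]$ and $D_{0+}^{n_0-\alpha_0}a_i\in C[0,T]$. Assume that $n_0\ge2$ and that there is $j_0\in\{0,\dots,n_0-2\}$ with $H_{j_0}=\emptyset$ and $H_{j_0+1}\ne\emptyset$. Then (1) has exactly one canonical fundamental system $y_0,\dots,y_{n_0-1}$ in $C^{n_0}_\gamma[0,T]$. It is given on $[0,T]$ by $$y_j=\Phi_{j+1},\qquad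 j=0,\dots,j_0,$$ $$y_j(t)=\Phi_{j+1}(t)+\sum_{k=0}^{\infty}(-1)^{k+1}I_{0+}^{\alpha_0}\Bigl[\sum_{i=1}^m a_i(t)I_{0+}^{\alpha_0-\alpha_i}\Bigr]^k\sum_{i=h_j}^m a_i(t)\Phi_{j+1-\alpha_i}(t),\qquad j=j_0+1,\dots,n_0-1,$$ where the series converges at every point of $[0,T]$ and its partial sums, with $\Phi_{j+1}$ added, converge to $y_j$ in the norm of $C^{n_0}_\gamma[0,T]$. -/

import Mathlib

open Set Filter Topology

noncomputable section

namespace CaputoODE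

/-- The Riemann–Liouville fractional integral `I_{0+}^α f`, with `I_{0+}^0 f = f`. -/
def rlIntegral (α : ℝ) (f : ℝ → ℝ) (t : ℝ) : ℝ :=
  if α = 0 then f t
  else (1 / Real.Gamma α) * ∫ τ in (0 : ℝ)..t, (t - τ) ^ (α - 1) * f τ

/-- The Riemann–Liouville fractional derivative `D_{0+}^α f = (d/dt)^n I_{0+}^{n-α} f`, where
`n = ⌈α⌉`, that is, `n - 1 < α ≤ n` (and `n = 0` for `α = 0`). -/
def rlDeriv (α : ℝ) (f : ℝ → ℝ) (t : ℝ) : ℝ :=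
  iteratedDeriv ⌈α⌉₊ (rlIntegral ((⌈α⌉₊ : ℝ) - α) f) t

/-- `D_{0+}^α f` exists on the open interval `(0, T)`: the function `I_{0+}^{n-α} f` is `n` times
differentiable there, `n = ⌈α⌉`. -/
def RLDifferentiable (T α : ℝ) (f : ℝ → ℝ) : Prop :=
  ∀ k < ⌈α⌉₊,
    DifferentiableOn ℝ (iteratedDeriv k (rlIntegral ((⌈α⌉₊ : ℝ) - α) f)) (Ioo 0 T)

/-- `f(t) - ∑_{k<n} f^{(k)}(0) t^k / k!`, for a function `f` on `[0, T]` (the derivatives at `0`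
are one-sided). -/
def taylorRemainder (T : ℝ) (n : ℕ) (f : ℝ → ℝ) (t : ℝ) : ℝ :=
  f t - ∑ k ∈ Finset.range n,
    iteratedDerivWithin k f (Icc 0 T) 0 / (k.factorial : ℝ) * t ^ k

/-- The Caputo fractional derivative of order `α` of a function on `[0, T]`. -/
def caputoDeriv (T α : ℝ) (f : ℝ → ℝ) (t : ℝ) : ℝ :=
  rlDeriv α (taylorRemainder T ⌈α⌉₊ f) t

/-- The Caputo derivative of order `α` of `f` exists on `(0, T)`. -/
def CaputoDifferentiable (T α : ℝ) (f : ℝ → ℝ) : Prop :=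
  RLDifferentiable T α (taylorRemainder T ⌈α⌉₊ f)

/-- The space `C_γ[0, T]`: `f` is defined on `(0, T]` and `t ↦ t^γ f(t)` is (the restriction of)
a continuous function on `[0, T]`. -/
def MemC (γ T : ℝ) (f : ℝ → ℝ) : Prop :=
  ∃ g : ℝ → ℝ, ContinuousOn g (Icc 0 T) ∧ ∀ t ∈ Ioc 0 T, t ^ γ * f t = g t

/-- The space `C_γ^n[0, T]`: `f` is `n - 1` times continuously differentiable on `[0, T]`, and has
an `n`-th derivative on `(0, T]` which belongs to `C_γ[0, T]`; moreover `C_γ^0 = C_γ`. -/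
def MemCn (γ T : ℝ) : ℕ → (ℝ → ℝ) → Prop
  | 0, f => MemC γ T f
  | n + 1, f =>
      ContDiffOn ℝ n f (Icc 0 T) ∧
      (∀ t ∈ Ioc 0 T,
        DifferentiableWithinAt ℝ (iteratedDerivWithin n f (Icc 0 T)) (Icc 0 T) t) ∧
      MemC γ T (iteratedDerivWithin (n + 1) f (Icc 0 T))

/-- Convergence of a sequence of elements of `C_γ^n[0, T]` in the norm
`∑_{k<n} sup_{[0,T]} |f^{(k)}| + sup_{(0,T]} |t^γ f^{(n)}(t)|`. -/
def ConvergesInCn (γ T : ℝ) (n : ℕ) (F : ℕ → ℝ → ℝ) (f : ℝ → ℝ) : Prop :=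
  (∀ N, MemCn γ T n (F N)) ∧ MemCn γ T n f ∧
  (∀ k < n, TendstoUniformlyOn (fun N => iteratedDerivWithin k (F N) (Icc 0 T))
      (iteratedDerivWithin k f (Icc 0 T)) atTop (Icc 0 T)) ∧
  TendstoUniformlyOn (fun N t => t ^ γ * iteratedDerivWithin n (F N) (Icc 0 T) t)
      (fun t => t ^ γ * iteratedDerivWithin n f (Icc 0 T) t) atTop (Ioc 0 T)

/-- `y` solves `ᶜD^{α₀} y(t) = - ∑_{i=1}^m a_i(t) ᶜD^{α_i} y(t)` for `0 < t < T`; all the Caputo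
derivatives that occur are required to exist. -/
def IsSolution (T : ℝ) (m : ℕ) (α : ℕ → ℝ) (a : ℕ → ℝ → ℝ) (y : ℝ → ℝ) : Prop :=
  (∀ i ≤ m, CaputoDifferentiable T (α i) y) ∧
  ∀ t ∈ Ioo 0 T,
    caputoDeriv T (α 0) y t = - ∑ i ∈ Finset.Icc 1 m, a i t * caputoDeriv T (α i) y t

/-- A canonical fundamental system of solutions `y_0, …, y_{n₀-1}` in `C_γ^{n₀}[0, T]`:
every `y_j` is a solution and `y_j^{(k)}(0) = δ_{jk}` for `0 ≤ k ≤ n₀ - 1`. -/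
def IsCanonicalSystem (γ T : ℝ) (m : ℕ) (α : ℕ → ℝ) (a : ℕ → ℝ → ℝ) (n₀ : ℕ)
    (y : Fin n₀ → ℝ → ℝ) : Prop :=
  ∀ j, MemCn γ T n₀ (y j) ∧ IsSolution T m α a (y j) ∧
    ∀ k : Fin n₀, iteratedDerivWithin (k : ℕ) (y j) (Icc 0 T) 0 = if j = k then 1 else 0

/-- `Φ_β(t) = t^{β-1} / Γ(β)`; in particular `Φ_{k+1}(t) = t^k / k!` for a natural number `k`. -/
def Phi (β t : ℝ) : ℝ := t ^ (β - 1) / Real.Gamma β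

/-- `H_j = {i : 0 ≤ α_i ≤ j, i = 1, …, m}`. -/
def H (m : ℕ) (α : ℕ → ℝ) (j : ℕ) : Set ℕ :=
  {i | 1 ≤ i ∧ i ≤ m ∧ 0 ≤ α i ∧ α i ≤ (j : ℝ)}

/-- `h_j = min H_j` (used only when `H_j` is nonempty). -/
def h (m : ℕ) (α : ℕ → ℝ) (j : ℕ) : ℕ := sInf (H m α j)

/-- The operator `f ↦ ∑_{i=1}^m a_i(t) I_{0+}^{α₀-α_i} f`. -/
def opL (m : ℕ) (α : ℕ → ℝ) (a : ℕ → ℝ → ℝ) (f : ℝ → ℝ) (t : ℝ) : ℝ :=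
  ∑ i ∈ Finset.Icc 1 m, a i t * rlIntegral (α 0 - α i) f t

/-- The term of index `k` of the series of the `j`-th element:
`(-1)^{k+1} I^{α₀} [∑_{i=1}^m a_i I^{α₀-α_i}]^k ∑_{i=h_j}^m a_i Φ_{j+1-α_i}`. -/
def seriesTerm (m : ℕ) (α : ℕ → ℝ) (a : ℕ → ℝ → ℝ) (j k : ℕ) (t : ℝ) : ℝ :=
  (-1) ^ (k + 1) * rlIntegral (α 0)
    ((opL m α a)^[k]
      (fun s => ∑ i ∈ Finset.Icc (h m α j) m, a i s * Phi ((j : ℝ) + 1 - α i) s)) t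

end CaputoODE

end

open Set Filter Topology

noncomputable section

namespace CaputoODE

open MeasureTheory intervalIntegral

theorem ofReal_beta_integrand {u v x : ℝ} (hx : x ∈ Icc (0 : ℝ) 1) :
    (x : ℂ) ^ ((u : ℂ) - 1) * (1 - (x : ℂ)) ^ ((v : ℂ) - 1) =
      ((x ^ (u - 1) * (1 - x) ^ (v - 1) : ℝ) : ℂ) := by
  have h1 : (0 : ℝ) ≤ 1 - x := by linarith [hx.2]
  rw [Complex.ofReal_mul, Complex.ofReal_cpow hx.1, Complex.ofReal_cpow h1]
  push_cast
  rfl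

theorem intervalIntegrable_beta {u v : ℝ} (hu : 0 < u) (hv : 0 < v) :
    IntervalIntegrable (fun x : ℝ => x ^ (u - 1) * (1 - x) ^ (v - 1)) volume 0 1 := by
  have h1 := (Complex.betaIntegral_convergent (u := u) (v := v) (by simpa) (by simpa)).norm
  refine h1.congr fun x hx => ?_
  rw [uIoc_of_le zero_le_one] at hx
  have hx' : x ∈ Icc (0 : ℝ) 1 := ⟨hx.1.le, hx.2⟩
  have h2 : (0 : ℝ) ≤ 1 - x := by linarith [hx.2]
  have h3 : 0 ≤ x ^ (u - 1) * (1 - x) ^ (v - 1) :=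
    mul_nonneg (Real.rpow_nonneg hx.1.le _) (Real.rpow_nonneg h2 _)
  simp only [ofReal_beta_integrand hx', Complex.norm_real, Real.norm_of_nonneg h3]

theorem integral_beta {u v : ℝ} (hu : 0 < u) (hv : 0 < v) :
    ∫ x in (0 : ℝ)..1, x ^ (u - 1) * (1 - x) ^ (v - 1) =
      Real.Gamma u * Real.Gamma v / Real.Gamma (u + v) := by
  have h1 := Complex.Gamma_mul_Gamma_eq_betaIntegral (s := u) (t := v) (by simpa) (by simpa)
  have h2 : Complex.betaIntegral u v =
      ((∫ x in (0 : ℝ)..1, x ^ (u - 1) * (1 - x) ^ (v - 1) : ℝ) : ℂ) := by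
    rw [Complex.betaIntegral, ← intervalIntegral.integral_ofReal]
    refine intervalIntegral.integral_congr fun x hx => ?_
    rw [uIcc_of_le zero_le_one] at hx
    exact ofReal_beta_integrand hx
  rw [h2, ← Complex.ofReal_add, Complex.Gamma_ofReal, Complex.Gamma_ofReal,
    Complex.Gamma_ofReal] at h1
  norm_cast at h1
  rw [h1, mul_div_cancel_left₀ _ (Real.Gamma_pos_of_pos (add_pos hu hv)).ne']

/-- The kernel `(1 - σ)^(b - 1) σ^(-γ)` of the fractional integral of `s^(-γ)`. -/
theorem intervalIntegrable_kernel {b γ : ℝ} (hb : 0 < b) (hγ : γ < 1) :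
    IntervalIntegrable (fun x : ℝ => (1 - x) ^ (b - 1) * x ^ (-γ)) volume 0 1 := by
  have h1 := intervalIntegrable_beta (u := 1 - γ) (v := b) (by linarith) hb
  refine h1.congr fun x _ => ?_
  simp only [mul_comm ((1 - x) ^ (b - 1))]
  congr 2
  ring

theorem rlIntegral_zero (f : ℝ → ℝ) (t : ℝ) : rlIntegral 0 f t = f t := by simp [rlIntegral]

theorem rlIntegral_of_pos {b : ℝ} (hb : 0 < b) (f : ℝ → ℝ) (t : ℝ) :
    rlIntegral b f t = (1 / Real.Gamma b) * ∫ τ in (0 : ℝ)..t, (t - τ) ^ (b - 1) * f τ := by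
  simp [rlIntegral, hb.ne']

theorem rlIntegral_at_zero {b : ℝ} (hb : 0 < b) (f : ℝ → ℝ) : rlIntegral b f 0 = 0 := by
  simp [rlIntegral_of_pos hb]

theorem rlIntegral_one (f : ℝ → ℝ) (t : ℝ) : rlIntegral 1 f t = ∫ τ in (0 : ℝ)..t, f τ := by
  simp [rlIntegral_of_pos one_pos]

theorem rlIntegral_congr {b t : ℝ} {f g : ℝ → ℝ} (hb : 0 < b) (ht : 0 ≤ t)
    (hfg : ∀ s ∈ Ioo 0 t, f s = g s) : rlIntegral b f t = rlIntegral b g t := by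
  rw [rlIntegral_of_pos hb, rlIntegral_of_pos hb]
  congr 1
  rw [integral_of_le ht, integral_of_le ht, integral_Ioc_eq_integral_Ioo,
    integral_Ioc_eq_integral_Ioo]
  refine setIntegral_congr_fun measurableSet_Ioo fun s hs => ?_
  simp only [hfg s hs]

theorem rlIntegral_congr_Ioc {b T t : ℝ} {f g : ℝ → ℝ} (hb : 0 ≤ b) (ht : t ∈ Ioc 0 T)
    (hfg : ∀ s ∈ Ioc 0 T, f s = g s) : rlIntegral b f t = rlIntegral b g t := by
  rcases hb.eq_or_lt with rfl | hb
  · rw [rlIntegral_zero, rlIntegral_zero, hfg t ht]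
  · exact rlIntegral_congr hb ht.1.le fun s hs => hfg s ⟨hs.1, hs.2.le.trans ht.2⟩

theorem rlIntegral_congr_Icc {b T t : ℝ} {f g : ℝ → ℝ} (hb : 0 < b) (ht : t ∈ Icc 0 T)
    (hfg : ∀ s ∈ Ioc 0 T, f s = g s) : rlIntegral b f t = rlIntegral b g t :=
  rlIntegral_congr hb ht.1 fun s hs => hfg s ⟨hs.1, hs.2.le.trans ht.2⟩

theorem integral_rl_scaled {b t : ℝ} (ht : 0 < t) (f : ℝ → ℝ) :
    ∫ τ in (0 : ℝ)..t, (t - τ) ^ (b - 1) * f τ =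
      t ^ b * ∫ σ in (0 : ℝ)..1, (1 - σ) ^ (b - 1) * f (t * σ) := by
  have h1 := integral_comp_mul_left (a := 0) (b := 1)
    (fun τ => (t - τ) ^ (b - 1) * f τ) ht.ne'
  simp only [mul_zero, mul_one, smul_eq_mul] at h1
  have h2 : ∫ σ in (0 : ℝ)..1, (t - t * σ) ^ (b - 1) * f (t * σ) =
      t ^ (b - 1) * ∫ σ in (0 : ℝ)..1, (1 - σ) ^ (b - 1) * f (t * σ) := by
    rw [← intervalIntegral.integral_const_mul]
    refine intervalIntegral.integral_congr fun σ hσ => ?_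
    rw [uIcc_of_le zero_le_one] at hσ
    rw [show t - t * σ = t * (1 - σ) by ring,
      Real.mul_rpow ht.le (by linarith [hσ.2]), mul_assoc]
  rw [h2] at h1
  have h3 : t ^ b = t * t ^ (b - 1) := by
    rw [Real.rpow_sub_one ht.ne']
    field_simp
  rw [h3, mul_assoc, h1, mul_inv_cancel_left₀ ht.ne']

theorem rlIntegral_scaled {b t : ℝ} (hb : 0 < b) (ht : 0 < t) (f : ℝ → ℝ) :
    rlIntegral b f t =
      t ^ b / Real.Gamma b * ∫ σ in (0 : ℝ)..1, (1 - σ) ^ (b - 1) * f (t * σ) := by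
  rw [rlIntegral_of_pos hb, integral_rl_scaled ht]
  ring

theorem rlIntegral_Phi {b c t : ℝ} (hb : 0 ≤ b) (hc : 0 < c) (ht : 0 < t) :
    rlIntegral b (Phi c) t = Phi (b + c) t := by
  rcases hb.eq_or_lt with rfl | hb
  · rw [rlIntegral_zero, zero_add]
  rw [rlIntegral_scaled hb ht]
  have h1 : ∫ σ in (0 : ℝ)..1, (1 - σ) ^ (b - 1) * Phi c (t * σ) =
      t ^ (c - 1) / Real.Gamma c * ∫ σ in (0 : ℝ)..1, σ ^ (c - 1) * (1 - σ) ^ (b - 1) := by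
    rw [← intervalIntegral.integral_const_mul]
    refine intervalIntegral.integral_congr fun σ hσ => ?_
    rw [uIcc_of_le zero_le_one] at hσ
    simp only [Phi]
    rw [Real.mul_rpow ht.le hσ.1]
    ring
  have h2 : t ^ (b + c - 1) = t ^ b * t ^ (c - 1) := by
    rw [← Real.rpow_add ht]
    ring_nf
  have := (Real.Gamma_pos_of_pos hb).ne'
  have := (Real.Gamma_pos_of_pos hc).ne'
  rw [h1, integral_beta hc hb, Phi, h2, add_comm c b]
  field_simp

theorem hasDerivAt_Phi {β t : ℝ} (hβ : β ≠ 1) (ht : 0 < t) :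
    HasDerivAt (Phi β) (Phi (β - 1) t) t := by
  have h1 := (Real.hasDerivAt_rpow_const (x := t) (p := β - 1) (Or.inl ht.ne')).div_const
    (Real.Gamma β)
  have h2 : (β - 1) * t ^ (β - 1 - 1) / Real.Gamma β = Phi (β - 1) t := by
    have h3 := Real.Gamma_add_one (sub_ne_zero.2 hβ)
    rw [sub_add_cancel] at h3
    rw [Phi, h3, mul_div_mul_left _ _ (sub_ne_zero.2 hβ)]
  rw [h2] at h1
  exact h1

theorem Phi_natCast_add_one (k : ℕ) (t : ℝ) :
    Phi ((k : ℝ) + 1) t = t ^ k / (k.factorial : ℝ) := by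
  rw [Phi, Real.Gamma_nat_eq_factorial, add_sub_cancel_right, Real.rpow_natCast]

theorem MemC.exists_rep {γ T : ℝ} {f : ℝ → ℝ} (hf : MemC γ T f) (hT : 0 < T) :
    ∃ q : ℝ → ℝ, Continuous q ∧ (∃ C, 0 ≤ C ∧ ∀ x, |q x| ≤ C) ∧
      ∀ t ∈ Ioc 0 T, f t = t ^ (-γ) * q t := by
  obtain ⟨g, hg, hfg⟩ := hf
  obtain ⟨C, hC⟩ := isCompact_Icc.exists_bound_of_continuousOn hg
  refine ⟨IccExtend hT.le ((Icc 0 T).domRestrict g),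
    (continuousOn_iff_continuous_domRestrict.1 hg).Icc_extend', ⟨|C|, abs_nonneg _, fun x => ?_⟩,
    fun t ht => ?_⟩
  · exact (hC _ (projIcc 0 T hT.le x).2).trans (le_abs_self C)
  · rw [IccExtend_of_mem _ _ (Ioc_subset_Icc_self ht), domRestrict_apply, ← hfg t ht, ← mul_assoc, ← Real.rpow_add ht.1, neg_add_cancel, Real.rpow_zero, one_mul]

theorem memC_of_rep {γ T : ℝ} {f q : ℝ → ℝ} (hq : ContinuousOn q (Icc 0 T))
    (hf : ∀ t ∈ Ioc 0 T, f t = t ^ (-γ) * q t) : MemC γ T f := by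
  refine ⟨q, hq, fun t ht => ?_⟩
  rw [hf t ht, ← mul_assoc, ← Real.rpow_add ht.1, add_neg_cancel, Real.rpow_zero, one_mul]

theorem MemC.exists_bound {γ T : ℝ} {f : ℝ → ℝ} (hf : MemC γ T f) (hT : 0 < T) :
    ∃ C, 0 ≤ C ∧ ∀ t ∈ Ioc 0 T, |f t| ≤ C * t ^ (-γ) := by
  obtain ⟨q, -, ⟨C, hC0, hC⟩, hfq⟩ := hf.exists_rep hT
  refine ⟨C, hC0, fun t ht => ?_⟩
  rw [hfq t ht, abs_mul, abs_of_nonneg (Real.rpow_nonneg ht.1.le _), mul_comm]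
  exact mul_le_mul_of_nonneg_right (hC t) (Real.rpow_nonneg ht.1.le _)

theorem memC_zero_of_continuousOn {T : ℝ} {f : ℝ → ℝ} (hf : ContinuousOn f (Icc 0 T)) :
    MemC 0 T f := ⟨f, hf, fun t _ => by simp⟩

theorem MemC.congr {γ T : ℝ} {f g : ℝ → ℝ} (hf : MemC γ T f) (hfg : ∀ t ∈ Ioc 0 T, g t = f t) :
    MemC γ T g := by
  obtain ⟨q, hq, h⟩ := hf
  exact ⟨q, hq, fun t ht => by rw [hfg t ht, h t ht]⟩

theorem MemC.add {γ T : ℝ} {f g : ℝ → ℝ} (hf : MemC γ T f) (hg : MemC γ T g) :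
    MemC γ T (fun t => f t + g t) := by
  obtain ⟨q, hq, h⟩ := hf
  obtain ⟨r, hr, h'⟩ := hg
  exact ⟨fun t => q t + r t, hq.add hr, fun t ht => by rw [mul_add, h t ht, h' t ht]⟩

theorem MemC.const_mul {γ T : ℝ} {f : ℝ → ℝ} (hf : MemC γ T f) (c : ℝ) :
    MemC γ T (fun t => c * f t) := by
  obtain ⟨q, hq, h⟩ := hf
  exact ⟨fun t => c * q t, continuousOn_const.mul hq,
    fun t ht => by simp only; rw [← h t ht]; ring⟩

theorem MemC.sub {γ T : ℝ} {f g : ℝ → ℝ} (hf : MemC γ T f) (hg : MemC γ T g) :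
    MemC γ T (fun t => f t - g t) := by
  obtain ⟨q, hq, h⟩ := hf
  obtain ⟨r, hr, h'⟩ := hg
  exact ⟨fun t => q t - r t, hq.sub hr, fun t ht => by rw [mul_sub, h t ht, h' t ht]⟩

theorem memC_zero_fun (γ T : ℝ) : MemC γ T (fun _ => 0) :=
  ⟨fun _ => 0, continuousOn_const, fun _ _ => mul_zero _⟩

theorem MemC.sum {ι : Type*} {γ T : ℝ} {s : Finset ι} {f : ι → ℝ → ℝ}
    (hf : ∀ i ∈ s, MemC γ T (f i)) : MemC γ T (fun t => ∑ i ∈ s, f i t) := by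
  classical
  induction s using Finset.induction_on with
  | empty => simpa using memC_zero_fun γ T
  | insert i s hi ih =>
    simp only [Finset.sum_insert hi]
    exact (hf i (Finset.mem_insert_self i s)).add
      (ih fun k hk => hf k (Finset.mem_insert_of_mem hk))

/-- Products: the exponents add up. -/
theorem MemC.mul {γ δ T : ℝ} {f g : ℝ → ℝ} (hf : MemC γ T f) (hg : MemC δ T g) :
    MemC (γ + δ) T (fun t => f t * g t) := by
  obtain ⟨q, hq, h⟩ := hf
  obtain ⟨r, hr, h'⟩ := hg
  refine ⟨fun t => q t * r t, hq.mul hr, fun t ht => ?_⟩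
  simp only
  rw [← h t ht, ← h' t ht, Real.rpow_add ht.1]
  ring

theorem MemC.mono {γ δ T : ℝ} {f : ℝ → ℝ} (hf : MemC γ T f) (hγδ : γ ≤ δ) : MemC δ T f := by
  obtain ⟨q, hq, h⟩ := hf
  refine ⟨fun t => t ^ (δ - γ) * q t,
    (Real.continuous_rpow_const (sub_nonneg.2 hγδ)).continuousOn.mul hq, fun t ht => ?_⟩
  simp only
  rw [← h t ht, ← mul_assoc, ← Real.rpow_add ht.1, sub_add_cancel]

theorem memC_rpow {c T : ℝ} : MemC (-c) T (fun t => t ^ c) :=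
  memC_of_rep (q := fun _ => 1) continuousOn_const fun t _ => by simp

theorem MemC.abs {γ T : ℝ} {f : ℝ → ℝ} (hf : MemC γ T f) : MemC γ T (fun t => |f t|) := by
  obtain ⟨q, hq, h⟩ := hf
  refine ⟨fun t => |q t|, hq.abs, fun t ht => ?_⟩
  simp only
  rw [← h t ht, abs_mul, abs_of_nonneg (Real.rpow_nonneg ht.1.le _)]

theorem MemC.continuousOn {γ T : ℝ} {f : ℝ → ℝ} (hf : MemC γ T f) (hT : 0 < T) :
    ContinuousOn f (Ioc 0 T) := by
  obtain ⟨q, hq, -, h⟩ := hf.exists_rep hT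
  refine ContinuousOn.congr ?_ h
  refine ContinuousOn.mul (fun t ht => ?_) hq.continuousOn
  exact (Real.continuousAt_rpow_const _ _ (Or.inl ht.1.ne')).continuousWithinAt

theorem intervalIntegrable_scaled {b γ T t : ℝ} {f : ℝ → ℝ} (hb : 0 < b) (hγ : γ < 1)
    (hf : MemC γ T f) (ht : t ∈ Ioc 0 T) :
    IntervalIntegrable (fun σ => (1 - σ) ^ (b - 1) * f (t * σ)) volume 0 1 := by
  obtain ⟨q, hq, -, h⟩ := hf.exists_rep (ht.1.trans_le ht.2)
  have h1 : IntervalIntegrable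
      (fun σ => t ^ (-γ) * ((1 - σ) ^ (b - 1) * σ ^ (-γ)) * q (t * σ)) volume 0 1 :=
    ((intervalIntegrable_kernel hb hγ).const_mul _).mul_continuousOn
      (hq.comp (continuous_const.mul continuous_id)).continuousOn
  refine h1.congr fun σ hσ => ?_
  rw [uIoc_of_le zero_le_one] at hσ
  rw [h (t * σ) ⟨mul_pos ht.1 hσ.1, (mul_le_of_le_one_right ht.1.le hσ.2).trans ht.2⟩,
    Real.mul_rpow ht.1.le hσ.1.le]
  ring

theorem intervalIntegrable_rl {b γ T t : ℝ} {f : ℝ → ℝ} (hb : 0 < b) (hγ : γ < 1)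
    (hf : MemC γ T f) (ht : t ∈ Icc 0 T) :
    IntervalIntegrable (fun τ => (t - τ) ^ (b - 1) * f τ) volume 0 t := by
  rcases ht.1.eq_or_lt with rfl | h0
  · simp
  have h1 := (intervalIntegrable_scaled hb hγ hf ⟨h0, ht.2⟩).comp_mul_left (c := t⁻¹)
  simp only [zero_mul, div_inv_eq_mul, one_mul] at h1
  refine (h1.const_mul (t ^ (b - 1))).congr fun τ hτ => ?_
  rw [uIoc_of_le ht.1] at hτ
  rw [mul_inv_cancel_left₀ h0.ne', ← mul_assoc,
    ← Real.mul_rpow h0.le (by rw [sub_nonneg, inv_mul_le_one₀ h0]; exact hτ.2), mul_sub, mul_one,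
    mul_inv_cancel_left₀ h0.ne']

theorem MemC.intervalIntegrable {γ T t : ℝ} {f : ℝ → ℝ} (hγ : γ < 1)
    (hf : MemC γ T f) (ht : t ∈ Icc 0 T) : IntervalIntegrable f volume 0 t := by
  simpa using intervalIntegrable_rl one_pos hγ hf ht

theorem rlIntegral_add {b γ T t : ℝ} {f g : ℝ → ℝ} (hb : 0 ≤ b) (hγ : γ < 1)
    (hf : MemC γ T f) (hg : MemC γ T g) (ht : t ∈ Icc 0 T) :
    rlIntegral b (fun s => f s + g s) t = rlIntegral b f t + rlIntegral b g t := by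
  rcases hb.eq_or_lt with rfl | hb
  · simp only [rlIntegral_zero]
  simp only [rlIntegral_of_pos hb, mul_add]
  rw [intervalIntegral.integral_add (intervalIntegrable_rl hb hγ hf ht)
    (intervalIntegrable_rl hb hγ hg ht), mul_add]

theorem rlIntegral_sub {b γ T t : ℝ} {f g : ℝ → ℝ} (hb : 0 ≤ b) (hγ : γ < 1)
    (hf : MemC γ T f) (hg : MemC γ T g) (ht : t ∈ Icc 0 T) :
    rlIntegral b (fun s => f s - g s) t = rlIntegral b f t - rlIntegral b g t := by
  rcases hb.eq_or_lt with rfl | hb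
  · simp only [rlIntegral_zero]
  simp only [rlIntegral_of_pos hb, mul_sub]
  rw [intervalIntegral.integral_sub (intervalIntegrable_rl hb hγ hf ht)
    (intervalIntegrable_rl hb hγ hg ht), mul_sub]

theorem rlIntegral_const_mul {b : ℝ} (f : ℝ → ℝ) (c t : ℝ) :
    rlIntegral b (fun s => c * f s) t = c * rlIntegral b f t := by
  unfold rlIntegral
  split_ifs
  · rfl
  · simp only [mul_left_comm _ c, intervalIntegral.integral_const_mul]

theorem rlIntegral_zero_fun (b t : ℝ) : rlIntegral b (fun _ => 0) t = 0 := by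
  simp [rlIntegral]

theorem rlIntegral_sum {ι : Type*} {b γ T t : ℝ} {s : Finset ι} {f : ι → ℝ → ℝ} (hb : 0 ≤ b)
    (hγ : γ < 1) (hf : ∀ i ∈ s, MemC γ T (f i)) (ht : t ∈ Icc 0 T) :
    rlIntegral b (fun x => ∑ i ∈ s, f i x) t = ∑ i ∈ s, rlIntegral b (f i) t := by
  classical
  induction s using Finset.induction_on with
  | empty => simpa using rlIntegral_zero_fun b t
  | insert i s hi ih =>
    have h1 : ∀ k ∈ s, MemC γ T (f k) := fun k hk => hf k (Finset.mem_insert_of_mem hk)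
    simp only [Finset.sum_insert hi]
    rw [rlIntegral_add hb hγ (hf i (Finset.mem_insert_self i s)) (MemC.sum h1) ht, ih h1]

/-- The norm of `σ^(-γ)` under the normalized kernel of `I^b`. -/
def kernelConst (b γ : ℝ) : ℝ :=
  (∫ σ in (0 : ℝ)..1, (1 - σ) ^ (b - 1) * σ ^ (-γ)) / Real.Gamma b

theorem kernelConst_nonneg {b : ℝ} (hb : 0 < b) (γ : ℝ) : 0 ≤ kernelConst b γ := by
  refine div_nonneg ?_ (Real.Gamma_pos_of_pos hb).le
  refine intervalIntegral.integral_nonneg zero_le_one fun σ hσ => ?_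
  exact mul_nonneg (Real.rpow_nonneg (by linarith [hσ.2]) _) (Real.rpow_nonneg hσ.1 _)

theorem abs_rlIntegral_le {b γ T t M : ℝ} {f : ℝ → ℝ} (hb : 0 < b) (hγ : γ < 1)
    (ht : t ∈ Ioc 0 T) (hM : ∀ s ∈ Ioc 0 T, |f s| ≤ M * s ^ (-γ)) :
    |rlIntegral b f t| ≤ M * kernelConst b γ * t ^ (b - γ) := by
  have hG := Real.Gamma_pos_of_pos hb
  have h1 : |∫ σ in (0 : ℝ)..1, (1 - σ) ^ (b - 1) * f (t * σ)| ≤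
      ∫ σ in (0 : ℝ)..1, M * t ^ (-γ) * ((1 - σ) ^ (b - 1) * σ ^ (-γ)) := by
    rw [← Real.norm_eq_abs]
    refine intervalIntegral.norm_integral_le_of_norm_le zero_le_one
      (Eventually.of_forall fun σ hσ => ?_) ((intervalIntegrable_kernel hb hγ).const_mul _)
    have h2 := hM (t * σ) ⟨mul_pos ht.1 hσ.1,
      (mul_le_of_le_one_right ht.1.le hσ.2).trans ht.2⟩
    have h3 : (0 : ℝ) ≤ (1 - σ) ^ (b - 1) := Real.rpow_nonneg (by linarith [hσ.2]) _
    rw [Real.norm_eq_abs, abs_mul, abs_of_nonneg h3]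
    refine (mul_le_mul_of_nonneg_left h2 h3).trans_eq ?_
    rw [Real.mul_rpow ht.1.le hσ.1.le]
    ring
  rw [intervalIntegral.integral_const_mul] at h1
  rw [rlIntegral_scaled hb ht.1, abs_mul,
    abs_of_nonneg (div_nonneg (Real.rpow_nonneg ht.1.le _) hG.le)]
  refine (mul_le_mul_of_nonneg_left h1
    (div_nonneg (Real.rpow_nonneg ht.1.le _) hG.le)).trans_eq ?_
  rw [kernelConst, sub_eq_add_neg b γ, Real.rpow_add ht.1]
  ring

theorem MemC.exists_rlIntegral_rep {b γ T : ℝ} {f : ℝ → ℝ} (hf : MemC γ T f) (hb : 0 < b)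
    (hγ : γ < 1) (hT : 0 < T) :
    ∃ Q : ℝ → ℝ, Continuous Q ∧ ∀ t ∈ Ioc 0 T, rlIntegral b f t = t ^ (b - γ) * Q t := by
  obtain ⟨q, hq, ⟨C, hC0, hC⟩, h⟩ := hf.exists_rep hT
  refine ⟨fun t => 1 / Real.Gamma b *
    ∫ σ in (0 : ℝ)..1, ((1 - σ) ^ (b - 1) * σ ^ (-γ)) * q (t * σ), ?_, fun t ht => ?_⟩
  · refine continuous_const.mul (continuous_of_dominated_interval (bound := fun σ =>
      C * ((1 - σ) ^ (b - 1) * σ ^ (-γ))) (fun t => ?_) (fun t => ?_)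
      ((intervalIntegrable_kernel hb hγ).const_mul _) ?_)
    · refine Measurable.aestronglyMeasurable ?_
      have : Measurable fun σ : ℝ => q (t * σ) := hq.measurable.comp (measurable_const_mul t)
      fun_prop
    · refine Eventually.of_forall fun σ hσ => ?_
      rw [uIoc_of_le zero_le_one] at hσ
      have h1 : 0 ≤ (1 - σ) ^ (b - 1) * σ ^ (-γ) :=
        mul_nonneg (Real.rpow_nonneg (by linarith [hσ.2]) _) (Real.rpow_nonneg hσ.1.le _)
      rw [Real.norm_eq_abs, abs_mul, abs_of_nonneg h1, mul_comm]
      exact mul_le_mul_of_nonneg_right (hC _) h1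
    · exact Eventually.of_forall fun σ _ =>
        continuous_const.mul (hq.comp (continuous_id.mul continuous_const))
  · have h1 : ∫ σ in (0 : ℝ)..1, (1 - σ) ^ (b - 1) * f (t * σ) =
        t ^ (-γ) * ∫ σ in (0 : ℝ)..1, ((1 - σ) ^ (b - 1) * σ ^ (-γ)) * q (t * σ) := by
      rw [← intervalIntegral.integral_const_mul]
      rw [integral_of_le zero_le_one, integral_of_le zero_le_one]
      refine setIntegral_congr_fun measurableSet_Ioc fun σ hσ => ?_
      rw [h (t * σ) ⟨mul_pos ht.1 hσ.1, (mul_le_of_le_one_right ht.1.le hσ.2).trans ht.2⟩,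
        Real.mul_rpow ht.1.le hσ.1.le]
      ring
    rw [rlIntegral_scaled hb ht.1, h1, sub_eq_add_neg b γ, Real.rpow_add ht.1]
    ring

theorem MemC.rlIntegral {b γ δ T : ℝ} {f : ℝ → ℝ} (hf : MemC γ T f) (hb : 0 ≤ b)
    (hγ : γ < 1) (hT : 0 < T) (hδ : γ - b ≤ δ) : MemC δ T (CaputoODE.rlIntegral b f) := by
  rcases hb.eq_or_lt with rfl | hb
  · exact (hf.mono (by simpa using hδ)).congr fun t _ => rlIntegral_zero f t
  obtain ⟨Q, hQ, h⟩ := hf.exists_rlIntegral_rep hb hγ hT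
  refine (memC_of_rep (γ := γ - b) hQ.continuousOn fun t ht => ?_).mono hδ
  rw [h t ht, neg_sub]

theorem MemC.continuousOn_rlIntegral {b γ T : ℝ} {f : ℝ → ℝ} (hf : MemC γ T f) (hb : 0 < b)
    (hγ : γ < 1) (hT : 0 < T) (hbγ : γ < b) :
    ContinuousOn (CaputoODE.rlIntegral b f) (Icc 0 T) := by
  obtain ⟨Q, hQ, h⟩ := hf.exists_rlIntegral_rep hb hγ hT
  refine ContinuousOn.congr (f := fun t => t ^ (b - γ) * Q t)
    ((Real.continuous_rpow_const (sub_pos.2 hbγ).le).mul hQ).continuousOn fun t ht => ?_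
  rcases ht.1.eq_or_lt with rfl | h0
  · simp only [rlIntegral_at_zero hb, Real.zero_rpow (sub_pos.2 hbγ).ne', zero_mul]
  · exact h t ⟨h0, ht.2⟩

theorem MemC.exists_extension {γ T : ℝ} {f : ℝ → ℝ} (hf : MemC γ T f) (hT : 0 < T) :
    ∃ g : ℝ → ℝ, (∀ S, MemC γ S g) ∧ Measurable g ∧ ∀ t ∈ Ioc 0 T, f t = g t := by
  obtain ⟨q, hq, -, h⟩ := hf.exists_rep hT
  have := hq.measurable
  exact ⟨fun t => t ^ (-γ) * q t, fun S => memC_of_rep hq.continuousOn fun _ _ => rfl,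
    by fun_prop, h⟩

theorem indicator_mul_indicator_sub (f k : ℝ → ℝ) (x : ℝ) :
    (fun t => (Ioi (0 : ℝ)).indicator f t * (Ioi (0 : ℝ)).indicator k (x - t)) =
      (Ioo 0 x).indicator fun t => k (x - t) * f t := by
  ext t
  by_cases h1 : 0 < t <;> by_cases h2 : t < x <;> simp [indicator, h1, h2, mul_comm]

theorem integrable_convolution_kernel {b γ : ℝ} {f : ℝ → ℝ} (hb : 0 < b) (hγ : γ < 1)
    (hf : ∀ S, MemC γ S f) (x : ℝ) :
    Integrable (fun t => (Ioi (0 : ℝ)).indicator f t *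
      (Ioi (0 : ℝ)).indicator (fun s => s ^ (b - 1)) (x - t)) := by
  rw [indicator_mul_indicator_sub, integrable_indicator_iff measurableSet_Ioo]
  rcases le_or_gt x 0 with hx | hx
  · simp [Ioo_eq_empty_of_le hx]
  · have h1 := intervalIntegrable_rl hb hγ (hf x) ⟨hx.le, le_rfl⟩
    rw [intervalIntegrable_iff_integrableOn_Ioo_of_le hx.le] at h1
    exact h1

theorem integral_convolution_kernel {b : ℝ} (hb : 0 < b) (f : ℝ → ℝ) (x : ℝ) :
    ∫ t, (Ioi (0 : ℝ)).indicator f t *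
      (Ioi (0 : ℝ)).indicator (fun s => s ^ (b - 1)) (x - t) =
      (Ioi (0 : ℝ)).indicator (fun s => Real.Gamma b * rlIntegral b f s) x := by
  rw [indicator_mul_indicator_sub, MeasureTheory.integral_indicator measurableSet_Ioo]
  rcases le_or_gt x 0 with hx | hx
  · simp [hx]
  · rw [indicator_of_mem (mem_Ioi.2 hx), rlIntegral_of_pos hb, integral_of_le hx.le,
      integral_Ioc_eq_integral_Ioo, ← mul_assoc,
      mul_one_div_cancel (Real.Gamma_pos_of_pos hb).ne', one_mul]

theorem rlIntegral_rpow {a b t : ℝ} (ha : 0 < a) (hb : 0 < b) (ht : 0 < t) :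
    rlIntegral a (fun s => s ^ (b - 1)) t =
      Real.Gamma b / Real.Gamma (a + b) * t ^ (a + b - 1) := by
  have h1 := rlIntegral_Phi ha.le hb ht
  have h2 : Phi b = fun s => (Real.Gamma b)⁻¹ * s ^ (b - 1) := by
    ext s
    rw [Phi, div_eq_inv_mul]
  rw [h2, rlIntegral_const_mul, inv_mul_eq_iff_eq_mul₀ (Real.Gamma_pos_of_pos hb).ne'] at h1
  rw [h1, Phi]
  ring

open scoped Convolution in
theorem rlIntegral_rlIntegral_global {a b γ t : ℝ} {f : ℝ → ℝ} (ha : 0 < a) (hb : 0 < b)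
    (hγ : γ < 1) (hf : ∀ S, MemC γ S f) (hfm : Measurable f) (ht : 0 < t) :
    rlIntegral a (rlIntegral b f) t = rlIntegral (a + b) f t := by
  set F := (Ioi (0 : ℝ)).indicator f with hF
  set k : ℝ → ℝ → ℝ := fun c => (Ioi (0 : ℝ)).indicator (fun s => s ^ (c - 1)) with hk
  have hkm : ∀ c, Measurable (k c) := fun c =>
    Measurable.indicator (by fun_prop) measurableSet_Ioi
  have hkabs : ∀ c, (fun x => ‖k c x‖) = k c := fun c => by
    ext x
    rw [Real.norm_of_nonneg]
    exact indicator_nonneg (fun s hs => Real.rpow_nonneg (mem_Ioi.1 hs).le _) x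
  have hFabs : (fun x => ‖F x‖) = (Ioi (0 : ℝ)).indicator fun s => |f s| := by
    ext x
    exact norm_indicator_eq_indicator_norm f x
  have hkk : k b ⋆[ContinuousLinearMap.mul ℝ ℝ] k a =
      fun x => (Real.Gamma a * Real.Gamma b / Real.Gamma (a + b)) * k (a + b) x := by
    ext x
    refine (integral_convolution_kernel ha _ x).trans ?_
    by_cases hx : 0 < x
    · simp only [hk, indicator_of_mem (mem_Ioi.2 hx)]
      rw [rlIntegral_rpow ha hb hx]
      ring
    · simp [hk, hx]
  have hpow : ∀ S, MemC (1 - b) S fun s => s ^ (b - 1) := fun S => by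
    simpa using memC_rpow (c := b - 1) (T := S)
  have h1 : ((F ⋆[ContinuousLinearMap.mul ℝ ℝ] k b) ⋆[ContinuousLinearMap.mul ℝ ℝ] k a) t =
      (F ⋆[ContinuousLinearMap.mul ℝ ℝ] (k b ⋆[ContinuousLinearMap.mul ℝ ℝ] k a)) t := by
    refine convolution_assoc _ _ _ _ (fun x y z => mul_assoc x y z)
      (hfm.indicator measurableSet_Ioi).aestronglyMeasurable
      (hkm b).aestronglyMeasurable (hkm a).aestronglyMeasurable
      (Eventually.of_forall fun y => integrable_convolution_kernel hb hγ hf y)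
      (Eventually.of_forall fun y => ?_) ?_
    · rw [hkabs, hkabs]
      exact integrable_convolution_kernel ha (by linarith) hpow y
    · rw [hkabs, hkabs, hFabs, hkk]
      have h2 := (integrable_convolution_kernel (add_pos ha hb) hγ (fun S => (hf S).abs) t).const_mul
        (Real.Gamma a * Real.Gamma b / Real.Gamma (a + b))
      refine h2.congr (Eventually.of_forall fun s => ?_)
      simp only [ContinuousLinearMap.mul_apply', hk]
      ring
  have h2 : F ⋆[ContinuousLinearMap.mul ℝ ℝ] k b =
      (Ioi (0 : ℝ)).indicator fun s => Real.Gamma b * rlIntegral b f s := by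
    ext x
    exact integral_convolution_kernel hb f x
  have h3 : ((F ⋆[ContinuousLinearMap.mul ℝ ℝ] k b) ⋆[ContinuousLinearMap.mul ℝ ℝ] k a) t =
      Real.Gamma a * (Real.Gamma b * rlIntegral a (rlIntegral b f) t) := by
    rw [h2]
    refine (integral_convolution_kernel ha _ t).trans ?_
    rw [indicator_of_mem (mem_Ioi.2 ht), rlIntegral_const_mul]
  have h4 : (F ⋆[ContinuousLinearMap.mul ℝ ℝ] (k b ⋆[ContinuousLinearMap.mul ℝ ℝ] k a)) t =
      Real.Gamma a * Real.Gamma b * rlIntegral (a + b) f t := by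
    rw [hkk]
    have h5 := integral_convolution_kernel (add_pos ha hb) f t
    rw [indicator_of_mem (mem_Ioi.2 ht)] at h5
    have h6 : (F ⋆[ContinuousLinearMap.mul ℝ ℝ] fun x =>
        (Real.Gamma a * Real.Gamma b / Real.Gamma (a + b)) * k (a + b) x) t =
        (Real.Gamma a * Real.Gamma b / Real.Gamma (a + b)) *
          ∫ s, F s * k (a + b) (t - s) := by
      rw [← MeasureTheory.integral_const_mul]
      refine integral_congr_ae (Eventually.of_forall fun s => ?_)
      simp only [ContinuousLinearMap.mul_apply']
      ring
    rw [h6, h5]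
    have := (Real.Gamma_pos_of_pos (add_pos ha hb)).ne'
    field_simp
  rw [h3, h4, ← mul_assoc] at h1
  exact mul_left_cancel₀
    (mul_pos (Real.Gamma_pos_of_pos ha) (Real.Gamma_pos_of_pos hb)).ne' h1

/-- The semigroup property of the fractional integral. -/
theorem rlIntegral_rlIntegral {a b γ T t : ℝ} {f : ℝ → ℝ} (ha : 0 ≤ a) (hb : 0 ≤ b)
    (hγ : γ < 1) (hf : MemC γ T f) (ht : t ∈ Icc 0 T) :
    rlIntegral a (rlIntegral b f) t = rlIntegral (a + b) f t := by
  rcases ha.eq_or_lt with rfl | ha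
  · rw [rlIntegral_zero, zero_add]
  rcases hb.eq_or_lt with rfl | hb
  · rw [add_zero]
    exact rlIntegral_congr ha ht.1 fun s _ => rlIntegral_zero f s
  rcases ht.1.eq_or_lt with rfl | h0
  · rw [rlIntegral_at_zero ha, rlIntegral_at_zero (add_pos ha hb)]
  have hT := h0.trans_le ht.2
  obtain ⟨g, hg, hgm, hfg⟩ := hf.exists_extension hT
  rw [rlIntegral_congr_Icc (add_pos ha hb) ht hfg,
    ← rlIntegral_rlIntegral_global ha hb hγ hg hgm h0]
  exact rlIntegral_congr_Icc ha ht fun s hs => rlIntegral_congr_Ioc hb.le hs hfg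

theorem hasDerivAt_rlIntegral {b γ T t : ℝ} {f : ℝ → ℝ} (hb : 0 ≤ b) (hγ : γ < 1)
    (hf : MemC γ T f) (ht : t ∈ Ioo 0 T) :
    HasDerivAt (rlIntegral (b + 1) f) (rlIntegral b f t) t := by
  have hT := ht.1.trans ht.2
  have hg : MemC γ T (rlIntegral b f) := hf.rlIntegral hb hγ hT (by linarith)
  have hgc : ContinuousOn (rlIntegral b f) (Ioo 0 T) :=
    (hg.continuousOn hT).mono Ioo_subset_Ioc_self
  have h1 := integral_hasDerivAt_right (hg.intervalIntegrable hγ ⟨ht.1.le, ht.2.le⟩)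
    (hgc.stronglyMeasurableAtFilter isOpen_Ioo t ht) (hgc.continuousAt (Ioo_mem_nhds ht.1 ht.2))
  refine h1.congr_of_eventuallyEq ?_
  filter_upwards [Ioo_mem_nhds ht.1 ht.2] with x hx
  rw [add_comm, ← rlIntegral_rlIntegral zero_le_one hb hγ hf ⟨hx.1.le, hx.2.le⟩, rlIntegral_one]

theorem hasDerivWithinAt_rlIntegral {b γ T t : ℝ} {f : ℝ → ℝ} (hb : 0 ≤ b) (hγ : γ < 1)
    (hf : MemC γ T f) (ht : t ∈ Ioc 0 T) :
    HasDerivWithinAt (rlIntegral (b + 1) f) (rlIntegral b f t) (Icc 0 T) t := by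
  have hT := ht.1.trans_le ht.2
  obtain ⟨g, hg, -, hfg⟩ := hf.exists_extension hT
  have h1 := (hasDerivAt_rlIntegral hb hγ (hg (T + 1))
    ⟨ht.1, by linarith [ht.2]⟩).hasDerivWithinAt (s := Icc 0 T)
  rw [← rlIntegral_congr_Ioc hb ht hfg] at h1
  exact h1.congr (fun x hx => rlIntegral_congr_Icc (by linarith) hx hfg)
    (rlIntegral_congr_Ioc (by linarith) ht hfg)

theorem hasDerivWithinAt_rlIntegral_Icc {b γ T t : ℝ} {f : ℝ → ℝ} (hb : 0 < b) (hγ : γ < 1)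
    (hbγ : γ < b) (hf : MemC γ T f) (hT : 0 < T) (ht : t ∈ Icc 0 T) :
    HasDerivWithinAt (rlIntegral (b + 1) f) (rlIntegral b f t) (Icc 0 T) t := by
  rcases ht.1.eq_or_lt with rfl | h0
  · have hc := hf.continuousOn_rlIntegral hb hγ hT hbγ
    have hG : Continuous (IccExtend hT.le ((Icc 0 T).domRestrict (rlIntegral b f))) :=
      (continuousOn_iff_continuous_domRestrict.1 hc).Icc_extend'
    have hGe : ∀ x ∈ Icc 0 T,
        IccExtend hT.le ((Icc 0 T).domRestrict (rlIntegral b f)) x = rlIntegral b f x :=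
      fun x hx => by rw [IccExtend_of_mem _ _ hx, domRestrict_apply]
    have h1 := (hG.integral_hasStrictDerivAt 0 0).hasDerivAt.hasDerivWithinAt (s := Icc 0 T)
    rw [hGe 0 ht] at h1
    have h2 : ∀ x ∈ Icc 0 T, rlIntegral (b + 1) f x =
        ∫ s in (0 : ℝ)..x, IccExtend hT.le ((Icc 0 T).domRestrict (rlIntegral b f)) s := by
      intro x hx
      rw [add_comm, ← rlIntegral_rlIntegral zero_le_one hb.le hγ hf hx, rlIntegral_one]
      refine intervalIntegral.integral_congr fun s hs => ?_
      rw [uIcc_of_le hx.1] at hs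
      exact (hGe s ⟨hs.1, hs.2.trans hx.2⟩).symm
    exact h1.congr h2 (h2 0 ht)
  · exact hasDerivWithinAt_rlIntegral hb.le hγ hf ⟨h0, ht.2⟩

theorem exp_neg_le_rpow {x δ : ℝ} (hx : 0 < x) (h0 : 0 ≤ δ) (h1 : δ ≤ 1) :
    Real.exp (-x) ≤ x ^ (-δ) := by
  rw [Real.exp_neg, Real.rpow_neg hx.le]
  refine inv_anti₀ (Real.rpow_pos_of_pos hx _) ?_
  rcases le_total x 1 with h | h
  · exact (Real.rpow_le_one hx.le h h0).trans (Real.one_le_exp hx.le)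
  · have h2 := Real.rpow_le_rpow_of_exponent_le h h1
    rw [Real.rpow_one] at h2
    linarith [Real.add_one_le_exp x]

theorem abs_rlIntegral_le_of_exp_bound {b γ δ T t M l : ℝ} {f : ℝ → ℝ} (hb : 0 < b) (hγ : γ < 1)
    (hδ0 : 0 < δ) (hδ1 : δ ≤ 1) (hδb : δ < b) (hM0 : 0 ≤ M) (hl : 0 < l) (ht : t ∈ Ioc 0 T)
    (hM : ∀ s ∈ Ioo 0 t, |f s| ≤ M * s ^ (-γ) * Real.exp (l * s)) :
    |rlIntegral b f t| ≤ T ^ (b - δ) * Real.Gamma (b - δ) / Real.Gamma b *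
      kernelConst (b - δ) γ * l ^ (-δ) * (M * t ^ (-γ) * Real.exp (l * t)) := by
  have hG := Real.Gamma_pos_of_pos hb
  have hG' := Real.Gamma_pos_of_pos (sub_pos.2 hδb)
  have hk := kernelConst_nonneg (sub_pos.2 hδb) γ
  have h1 : |∫ σ in (0 : ℝ)..1, (1 - σ) ^ (b - 1) * f (t * σ)| ≤
      ∫ σ in (0 : ℝ)..1, (M * t ^ (-γ) * Real.exp (l * t)) * (l ^ (-δ) * t ^ (-δ)) *
        ((1 - σ) ^ (b - δ - 1) * σ ^ (-γ)) := by
    rw [← Real.norm_eq_abs]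
    refine intervalIntegral.norm_integral_le_of_norm_le zero_le_one ?_
      ((intervalIntegrable_kernel (sub_pos.2 hδb) hγ).const_mul _)
    filter_upwards [compl_mem_ae_iff.2 (measure_singleton (1 : ℝ))] with σ hσ1 hσ
    have hσ' : 0 < 1 - σ := sub_pos.2 (lt_of_le_of_ne hσ.2 hσ1)
    have h2 := hM (t * σ) ⟨mul_pos ht.1 hσ.1, by nlinarith [ht.1]⟩
    have h3 : (0 : ℝ) ≤ (1 - σ) ^ (b - 1) := Real.rpow_nonneg hσ'.le _
    have h4 : Real.exp (l * (t * σ)) ≤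
        Real.exp (l * t) * (l ^ (-δ) * t ^ (-δ) * (1 - σ) ^ (-δ)) := by
      have h5 := exp_neg_le_rpow (mul_pos (mul_pos hl ht.1) hσ') hδ0.le hδ1
      rw [Real.mul_rpow (mul_pos hl ht.1).le hσ'.le, Real.mul_rpow hl.le ht.1.le] at h5
      calc Real.exp (l * (t * σ)) = Real.exp (l * t) * Real.exp (-(l * t * (1 - σ))) := by
            rw [← Real.exp_add]
            ring_nf
        _ ≤ _ := mul_le_mul_of_nonneg_left h5 (Real.exp_pos _).le
    have h6 : (1 - σ) ^ (b - δ - 1) = (1 - σ) ^ (b - 1) * (1 - σ) ^ (-δ) := by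
      rw [← Real.rpow_add hσ']
      ring_nf
    have h7 : 0 ≤ M * (t * σ) ^ (-γ) :=
      mul_nonneg hM0 (Real.rpow_nonneg (mul_pos ht.1 hσ.1).le _)
    rw [Real.norm_eq_abs, abs_mul, abs_of_nonneg h3]
    refine (mul_le_mul_of_nonneg_left (h2.trans (mul_le_mul_of_nonneg_left h4 h7)) h3).trans_eq ?_
    rw [Real.mul_rpow ht.1.le hσ.1.le, h6]
    ring
  rw [intervalIntegral.integral_const_mul] at h1
  have h8 : ∫ σ in (0 : ℝ)..1, (1 - σ) ^ (b - δ - 1) * σ ^ (-γ) =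
      Real.Gamma (b - δ) * kernelConst (b - δ) γ := by
    rw [kernelConst, mul_div_cancel₀ _ hG'.ne']
  rw [h8] at h1
  rw [rlIntegral_scaled hb ht.1, abs_mul,
    abs_of_nonneg (div_nonneg (Real.rpow_nonneg ht.1.le _) hG.le)]
  refine (mul_le_mul_of_nonneg_left h1
    (div_nonneg (Real.rpow_nonneg ht.1.le _) hG.le)).trans ?_
  have h9 : t ^ b * t ^ (-δ) ≤ T ^ (b - δ) := by
    rw [← Real.rpow_add ht.1, ← sub_eq_add_neg]
    exact Real.rpow_le_rpow ht.1.le ht.2 (sub_pos.2 hδb).le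
  have h10 : 0 ≤ Real.Gamma (b - δ) / Real.Gamma b * kernelConst (b - δ) γ * l ^ (-δ) *
      (M * t ^ (-γ) * Real.exp (l * t)) :=
    mul_nonneg (mul_nonneg (mul_nonneg (div_nonneg hG'.le hG.le) hk) (Real.rpow_nonneg hl.le _))
      (mul_nonneg (mul_nonneg hM0 (Real.rpow_nonneg ht.1.le _)) (Real.exp_pos _).le)
  calc _ = t ^ b * t ^ (-δ) * (Real.Gamma (b - δ) / Real.Gamma b * kernelConst (b - δ) γ *
        l ^ (-δ) * (M * t ^ (-γ) * Real.exp (l * t))) := by ring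
    _ ≤ T ^ (b - δ) * (Real.Gamma (b - δ) / Real.Gamma b * kernelConst (b - δ) γ *
        l ^ (-δ) * (M * t ^ (-γ) * Real.exp (l * t))) := mul_le_mul_of_nonneg_right h9 h10
    _ = _ := by ring

/-- In the norm `sup |t^γ e^(-l t) f(t)|` the fractional integral is a contraction, with a constant
that tends to zero as `l → ∞`. -/
theorem eventually_abs_rlIntegral_le {b γ η : ℝ} (T : ℝ) (hb : 0 < b) (hγ : γ < 1)
    (hη : 0 < η) :
    ∀ᶠ l in atTop, ∀ t ∈ Ioc 0 T, ∀ (f : ℝ → ℝ) (M : ℝ), 0 ≤ M →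
      (∀ s ∈ Ioo 0 t, |f s| ≤ M * s ^ (-γ) * Real.exp (l * s)) →
      |rlIntegral b f t| ≤ η * (M * t ^ (-γ) * Real.exp (l * t)) := by
  have hm : 0 < min b 1 := lt_min hb one_pos
  have h1 : min b 1 / 2 < b := (half_lt_self hm).trans_le (min_le_left _ _)
  have h2 : min b 1 / 2 ≤ 1 := (half_lt_self hm).le.trans (min_le_right _ _)
  set δ := min b 1 / 2 with hδ
  have hδ0 : 0 < δ := half_pos hm
  have h3 : Tendsto (fun l : ℝ => T ^ (b - δ) * Real.Gamma (b - δ) / Real.Gamma b *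
      kernelConst (b - δ) γ * l ^ (-δ)) atTop (𝓝 0) := by
    simpa using (tendsto_rpow_neg_atTop hδ0).const_mul
      (T ^ (b - δ) * Real.Gamma (b - δ) / Real.Gamma b * kernelConst (b - δ) γ)
  filter_upwards [h3.eventually_lt_const hη, eventually_gt_atTop 0] with l hl hl0 t ht f M hM0 hM
  refine (abs_rlIntegral_le_of_exp_bound hb hγ hδ0 h2 h1 hM0 hl0 ht hM).trans ?_
  exact mul_le_mul_of_nonneg_right hl.le
    (mul_nonneg (mul_nonneg hM0 (Real.rpow_nonneg ht.1.le _)) (Real.exp_pos _).le)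

/-- A continuous function that vanishes at zero is the integral of its derivative. -/
theorem eq_rlIntegral_one_of_hasDerivAt {γ T : ℝ} {F f : ℝ → ℝ} (hγ : γ < 1) (hf : MemC γ T f)
    (hF : ContinuousOn F (Icc 0 T)) (hF0 : F 0 = 0) (hd : ∀ t ∈ Ioo 0 T, HasDerivAt F (f t) t)
    {t : ℝ} (ht : t ∈ Icc 0 T) : F t = rlIntegral 1 f t := by
  rw [rlIntegral_one, integral_eq_sub_of_hasDerivAt_of_le ht.1 (hF.mono (Icc_subset_Icc_right ht.2))
    (fun x hx => hd x ⟨hx.1, hx.2.trans_le ht.2⟩) (hf.intervalIntegrable hγ ht), hF0, sub_zero]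

theorem hasDerivAt_of_eq_rlIntegral_one {γ T : ℝ} {F f : ℝ → ℝ} (hγ : γ < 1) (hf : MemC γ T f)
    (hF : ∀ t ∈ Icc 0 T, F t = rlIntegral 1 f t) {t : ℝ} (ht : t ∈ Ioo 0 T) :
    HasDerivAt F (f t) t := by
  have h1 := hasDerivAt_rlIntegral le_rfl hγ hf ht
  rw [zero_add, rlIntegral_zero] at h1
  refine h1.congr_of_eventuallyEq ?_
  filter_upwards [Ioo_mem_nhds ht.1 ht.2] with x hx
  exact hF x ⟨hx.1.le, hx.2.le⟩

theorem continuousOn_of_eq_rlIntegral_one {γ T : ℝ} {F f : ℝ → ℝ} (hT : 0 < T) (hγ : γ < 1)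
    (hf : MemC γ T f) (hF : ∀ t ∈ Icc 0 T, F t = rlIntegral 1 f t) : ContinuousOn F (Icc 0 T) :=
  (hf.continuousOn_rlIntegral one_pos hγ hT hγ).congr hF

theorem mul_eq_rlIntegral_one {γ T : ℝ} {F f G g : ℝ → ℝ} (hT : 0 < T) (hγ : γ < 1)
    (hf : MemC γ T f) (hF : ∀ t ∈ Icc 0 T, F t = rlIntegral 1 f t)
    (hG : ContinuousOn G (Icc 0 T)) (hg : ∀ t ∈ Ioo 0 T, HasDerivAt G (g t) t)
    (hp : MemC γ T fun t => f t * G t + F t * g t) {t : ℝ} (ht : t ∈ Icc 0 T) :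
    F t * G t = rlIntegral 1 (fun t => f t * G t + F t * g t) t := by
  refine eq_rlIntegral_one_of_hasDerivAt (F := fun t => F t * G t) hγ hp
    ((continuousOn_of_eq_rlIntegral_one hT hγ hf hF).mul hG) ?_ (fun x hx => ?_) ht
  · rw [hF 0 ⟨le_rfl, hT.le⟩, rlIntegral_at_zero one_pos, zero_mul]
  · exact (hasDerivAt_of_eq_rlIntegral_one hγ hf hF hx).mul (hg x hx)

theorem MemC.of_eq_rlIntegral_one {γ T : ℝ} {F f : ℝ → ℝ} (hT : 0 < T) (hγ : γ < 1)
    (hf : MemC γ T f) (hF : ∀ t ∈ Icc 0 T, F t = CaputoODE.rlIntegral 1 f t) :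
    MemC (γ - 1) T F :=
  (hf.rlIntegral zero_le_one hγ hT le_rfl).congr fun t ht => hF t ⟨ht.1.le, ht.2⟩

theorem memC_Phi (β T : ℝ) : MemC (1 - β) T (Phi β) := by
  have h := (memC_rpow (c := β - 1) (T := T)).const_mul (Real.Gamma β)⁻¹
  rw [neg_sub] at h
  exact h.congr fun t _ => by rw [Phi, div_eq_inv_mul]

theorem hasDerivAt_Phi' {β t : ℝ} (ht : 0 < t) : HasDerivAt (Phi β) (Phi (β - 1) t) t := by
  by_cases hβ : β = 1
  · subst hβ
    have h1 : Phi 1 = fun _ => 1 := by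
      ext s
      simp [Phi]
    have h2 : Phi (1 - 1) t = 0 := by simp [Phi, Real.Gamma_zero]
    rw [h1, h2]
    exact hasDerivAt_const t 1
  · exact hasDerivAt_Phi hβ ht

theorem continuous_Phi {β : ℝ} (hβ : 1 ≤ β) : Continuous (Phi β) :=
  (Real.continuous_rpow_const (sub_nonneg.2 hβ)).div_const _

/-- The derivative of `A Φ_β`. -/
theorem memC_deriv_mul_Phi {γ β T : ℝ} {A A' : ℝ → ℝ} (hT : 0 < T) (hγ : γ < 1)
    (hA' : MemC γ T A') (hA : ∀ t ∈ Icc 0 T, A t = rlIntegral 1 A' t) (hβ : 1 ≤ β) :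
    MemC γ T fun t => A' t * Phi β t + A t * Phi (β - 1) t :=
  ((hA'.mul (memC_Phi β T)).mono (by linarith)).add
    (((hA'.of_eq_rlIntegral_one hT hγ hA).mul (memC_Phi (β - 1) T)).mono (by linarith))

theorem mul_Phi_eq_rlIntegral_one {γ β T : ℝ} {A A' : ℝ → ℝ} (hT : 0 < T) (hγ : γ < 1)
    (hA' : MemC γ T A') (hA : ∀ t ∈ Icc 0 T, A t = rlIntegral 1 A' t) (hβ : 1 ≤ β)
    {t : ℝ} (ht : t ∈ Icc 0 T) :
    A t * Phi β t = rlIntegral 1 (fun t => A' t * Phi β t + A t * Phi (β - 1) t) t :=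
  mul_eq_rlIntegral_one hT hγ hA' hA (continuous_Phi hβ).continuousOn
    (fun _ hx => hasDerivAt_Phi' hx.1) (memC_deriv_mul_Phi hT hγ hA' hA hβ) ht

/-- The derivative of `A I^b I^1 p`. -/
theorem memC_deriv_mul_rlIntegral {γ b T : ℝ} {A A' p : ℝ → ℝ} (hT : 0 < T) (hγ : γ < 1)
    (hb : 0 ≤ b) (hA' : MemC γ T A') (hA : ∀ t ∈ Icc 0 T, A t = rlIntegral 1 A' t)
    (hp : MemC γ T p) :
    MemC γ T fun t => A' t * rlIntegral (b + 1) p t + A t * rlIntegral b p t :=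
  ((hA'.mul (hp.rlIntegral (δ := 0) (by linarith) hγ hT (by linarith))).mono (by linarith)).add
    (((hA'.of_eq_rlIntegral_one hT hγ hA).mul (hp.rlIntegral hb hγ hT le_rfl)).mono (by linarith))

theorem mul_rlIntegral_eq_rlIntegral_one {γ b T : ℝ} {A A' p u : ℝ → ℝ} (hT : 0 < T) (hγ : γ < 1)
    (hb : 0 < b) (hA' : MemC γ T A') (hA : ∀ t ∈ Icc 0 T, A t = rlIntegral 1 A' t)
    (hp : MemC γ T p) (hu : ∀ t ∈ Icc 0 T, u t = rlIntegral 1 p t)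
    {t : ℝ} (ht : t ∈ Icc 0 T) :
    A t * rlIntegral b u t = rlIntegral 1
      (fun t => A' t * rlIntegral (b + 1) p t + A t * rlIntegral b p t) t := by
  rw [rlIntegral_congr_Icc hb ht fun s hs => hu s ⟨hs.1.le, hs.2⟩,
    rlIntegral_rlIntegral hb.le zero_le_one hγ hp ht]
  exact mul_eq_rlIntegral_one hT hγ hA' hA
    (hp.continuousOn_rlIntegral (by linarith) hγ hT (by linarith))
    (fun x hx => hasDerivAt_rlIntegral hb.le hγ hp hx)
    (memC_deriv_mul_rlIntegral hT hγ hb.le hA' hA hp) ht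

theorem eventually_deriv_mul_rlIntegral_le {γ b T η : ℝ} {A A' : ℝ → ℝ} (hT : 0 < T)
    (hγ : γ < 1) (hb : 0 < b) (hA' : MemC γ T A') (hA : ContinuousOn A (Icc 0 T)) (hη : 0 < η) :
    ∀ᶠ l in atTop, ∀ (p : ℝ → ℝ) (M : ℝ), MemC γ T p → 0 ≤ M →
      (∀ t ∈ Ioc 0 T, |p t| ≤ M * t ^ (-γ) * Real.exp (l * t)) →
      ∀ t ∈ Ioc 0 T, |A' t * rlIntegral (b + 1) p t + A t * rlIntegral b p t| ≤
        η * (M * t ^ (-γ) * Real.exp (l * t)) := by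
  obtain ⟨K, hK0, hK⟩ := hA'.exists_bound hT
  obtain ⟨K', hK'0, hK'⟩ := (memC_zero_of_continuousOn hA).exists_bound hT
  set c := kernelConst 1 γ * T ^ (1 - γ) with hc
  have hc0 : 0 ≤ c := mul_nonneg (kernelConst_nonneg one_pos γ) (Real.rpow_nonneg hT.le _)
  set D := K * c + K' + 1 with hD
  have hKc := mul_nonneg hK0 hc0
  have hD0 : 0 < D := by linarith
  have hηD : 0 < η / D := div_pos hη hD0
  filter_upwards [eventually_abs_rlIntegral_le T hb hγ hηD,
    eventually_abs_rlIntegral_le T hb (zero_lt_one : (0 : ℝ) < 1) hηD, eventually_ge_atTop 0]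
    with l h1 h2 hl p M hp hM0 hM t ht
  have hE : 0 ≤ M * t ^ (-γ) * Real.exp (l * t) :=
    mul_nonneg (mul_nonneg hM0 (Real.rpow_nonneg ht.1.le _)) (Real.exp_pos _).le
  have h3 := h1 t ht p M hM0 fun s hs => hM s ⟨hs.1, hs.2.le.trans ht.2⟩
  have h4 : ∀ s ∈ Ioo 0 t, |rlIntegral 1 p s| ≤ M * c * s ^ (-(0 : ℝ)) * Real.exp (l * s) := by
    intro s hs
    have h5 := abs_rlIntegral_le (M := M * Real.exp (l * s)) one_pos hγ
      (⟨hs.1, le_rfl⟩ : s ∈ Ioc 0 s) (f := p) (fun x hx => by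
        refine (hM x ⟨hx.1, hx.2.trans (hs.2.le.trans ht.2)⟩).trans ?_
        rw [mul_right_comm]
        refine mul_le_mul_of_nonneg_right (mul_le_mul_of_nonneg_left ?_ hM0)
          (Real.rpow_nonneg hx.1.le _)
        exact Real.exp_le_exp.2 (mul_le_mul_of_nonneg_left hx.2 hl))
    refine h5.trans ?_
    have h6 : s ^ (1 - γ) ≤ T ^ (1 - γ) :=
      Real.rpow_le_rpow hs.1.le (hs.2.le.trans ht.2) (by linarith)
    rw [neg_zero, Real.rpow_zero, mul_one, hc]
    calc _ ≤ M * Real.exp (l * s) * kernelConst 1 γ * T ^ (1 - γ) :=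
          mul_le_mul_of_nonneg_left h6 (mul_nonneg (mul_nonneg hM0 (Real.exp_pos _).le)
            (kernelConst_nonneg one_pos γ))
      _ = _ := by ring
  have h5 := h2 t ht (rlIntegral 1 p) (M * c) (mul_nonneg hM0 hc0) h4
  rw [rlIntegral_rlIntegral hb.le zero_le_one hγ hp ⟨ht.1.le, ht.2⟩, neg_zero, Real.rpow_zero,
    mul_one] at h5
  have h6 := hK t ht
  have h7 := hK' t ht
  rw [neg_zero, Real.rpow_zero, mul_one] at h7
  have hKt : 0 ≤ K * t ^ (-γ) := mul_nonneg hK0 (Real.rpow_nonneg ht.1.le _)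
  calc |A' t * rlIntegral (b + 1) p t + A t * rlIntegral b p t|
      ≤ |A' t| * |rlIntegral (b + 1) p t| + |A t| * |rlIntegral b p t| := by
        rw [← abs_mul, ← abs_mul]
        exact abs_add_le _ _
    _ ≤ K * t ^ (-γ) * (η / D * (M * c * Real.exp (l * t))) +
        K' * (η / D * (M * t ^ (-γ) * Real.exp (l * t))) :=
        add_le_add (mul_le_mul h6 h5 (abs_nonneg _) hKt) (mul_le_mul h7 h3 (abs_nonneg _) hK'0)
    _ = (K * c + K') / D * (η * (M * t ^ (-γ) * Real.exp (l * t))) := by ring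
    _ ≤ 1 * (η * (M * t ^ (-γ) * Real.exp (l * t))) := by
        refine mul_le_mul_of_nonneg_right ?_ (mul_nonneg hη.le hE)
        rw [div_le_one hD0]
        linarith
    _ = _ := one_mul _

theorem eventually_mul_rlIntegral_le {b T η : ℝ} {A : ℝ → ℝ} (hT : 0 < T) (hb : 0 < b)
    (hA : ContinuousOn A (Icc 0 T)) (hη : 0 < η) :
    ∀ᶠ l in atTop, ∀ (v : ℝ → ℝ) (M : ℝ), 0 ≤ M →
      (∀ t ∈ Ioo 0 T, |v t| ≤ M * Real.exp (l * t)) →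
      ∀ t ∈ Ioo 0 T, |A t * rlIntegral b v t| ≤ η * (M * Real.exp (l * t)) := by
  obtain ⟨K, hK0, hK⟩ := (memC_zero_of_continuousOn hA).exists_bound hT
  have hK1 : 0 < K + 1 := by linarith
  filter_upwards [eventually_abs_rlIntegral_le T hb (zero_lt_one : (0 : ℝ) < 1)
    (div_pos hη hK1)] with l h1 v M hM0 hM t ht
  have h2 := h1 t ⟨ht.1, ht.2.le⟩ v M hM0 fun s hs => by
    simpa using hM s ⟨hs.1, hs.2.trans ht.2⟩
  have h3 := hK t ⟨ht.1, ht.2.le⟩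
  rw [neg_zero, Real.rpow_zero, mul_one] at h2 h3
  have hE : 0 ≤ M * Real.exp (l * t) := mul_nonneg hM0 (Real.exp_pos _).le
  calc |A t * rlIntegral b v t| = |A t| * |rlIntegral b v t| := abs_mul _ _
    _ ≤ K * (η / (K + 1) * (M * Real.exp (l * t))) := mul_le_mul h3 h2 (abs_nonneg _) hK0
    _ = K / (K + 1) * (η * (M * Real.exp (l * t))) := by ring
    _ ≤ 1 * (η * (M * Real.exp (l * t))) := by
        refine mul_le_mul_of_nonneg_right ?_ (mul_nonneg hη.le hE)
        rw [div_le_one hK1]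
        linarith
    _ = _ := one_mul _

/-- The coefficients `a_i` are the integrals of functions `a'_i ∈ C_γ[0, T]`, and the orders
`α_1, …, α_m` are smaller than `α_0`. -/
structure IsVolterraSystem (γ T : ℝ) (m : ℕ) (α : ℕ → ℝ) (a a' : ℕ → ℝ → ℝ) : Prop where
  pos : 0 < T
  lt_one : γ < 1
  order_lt : ∀ i ∈ Finset.Icc 1 m, α i < α 0
  memC : ∀ i ∈ Finset.Icc 1 m, MemC γ T (a' i)
  eq_integral : ∀ i ∈ Finset.Icc 1 m, ∀ t ∈ Icc 0 T, a i t = rlIntegral 1 (a' i) t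

/-- The operator induced by `opL` on derivatives. -/
def opD (m : ℕ) (α : ℕ → ℝ) (a a' : ℕ → ℝ → ℝ) (p : ℝ → ℝ) (t : ℝ) : ℝ :=
  ∑ i ∈ Finset.Icc 1 m,
    (a' i t * rlIntegral (α 0 - α i + 1) p t + a i t * rlIntegral (α 0 - α i) p t)

theorem opD_const_mul (m : ℕ) (α : ℕ → ℝ) (a a' : ℕ → ℝ → ℝ) (p : ℝ → ℝ) (c t : ℝ) :
    opD m α a a' (fun s => c * p s) t = c * opD m α a a' p t := by
  simp only [opD, rlIntegral_const_mul, Finset.mul_sum]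
  exact Finset.sum_congr rfl fun i _ => by ring

namespace IsVolterraSystem

variable {γ T : ℝ} {m : ℕ} {α : ℕ → ℝ} {a a' : ℕ → ℝ → ℝ}

theorem continuousOn (hs : IsVolterraSystem γ T m α a a') {i : ℕ} (hi : i ∈ Finset.Icc 1 m) :
    ContinuousOn (a i) (Icc 0 T) :=
  continuousOn_of_eq_rlIntegral_one hs.pos hs.lt_one (hs.memC i hi) (hs.eq_integral i hi)

theorem memC_opD (hs : IsVolterraSystem γ T m α a a') {p : ℝ → ℝ} (hp : MemC γ T p) :
    MemC γ T (opD m α a a' p) :=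
  MemC.sum fun i hi => memC_deriv_mul_rlIntegral hs.pos hs.lt_one
    (sub_pos.2 (hs.order_lt i hi)).le (hs.memC i hi) (hs.eq_integral i hi) hp

theorem opL_eq_rlIntegral_one (hs : IsVolterraSystem γ T m α a a') {p u : ℝ → ℝ}
    (hp : MemC γ T p) (hu : ∀ t ∈ Icc 0 T, u t = rlIntegral 1 p t) {t : ℝ} (ht : t ∈ Icc 0 T) :
    opL m α a u t = rlIntegral 1 (opD m α a a' p) t := by
  have h1 := rlIntegral_sum (s := Finset.Icc 1 m) (b := 1)
    (f := fun i t => a' i t * rlIntegral (α 0 - α i + 1) p t + a i t * rlIntegral (α 0 - α i) p t)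
    zero_le_one hs.lt_one (fun i hi => memC_deriv_mul_rlIntegral hs.pos hs.lt_one
      (sub_pos.2 (hs.order_lt i hi)).le (hs.memC i hi) (hs.eq_integral i hi) hp) ht
  refine Eq.trans ?_ h1.symm
  exact Finset.sum_congr rfl fun i hi => mul_rlIntegral_eq_rlIntegral_one hs.pos hs.lt_one
    (sub_pos.2 (hs.order_lt i hi)) (hs.memC i hi) (hs.eq_integral i hi) hp hu ht

theorem exists_contraction_opD (hs : IsVolterraSystem γ T m α a a') :
    ∃ l : ℝ, ∀ (p : ℝ → ℝ) (M : ℝ), MemC γ T p → 0 ≤ M →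
      (∀ t ∈ Ioc 0 T, |p t| ≤ M * t ^ (-γ) * Real.exp (l * t)) →
      ∀ t ∈ Ioc 0 T, |opD m α a a' p t| ≤ (M / 2) * t ^ (-γ) * Real.exp (l * t) := by
  have hη : (0 : ℝ) < 1 / (2 * (m + 1)) := by positivity
  have h1 : ∀ i ∈ Finset.Icc 1 m, _ := fun i hi =>
    eventually_deriv_mul_rlIntegral_le (A := a i) hs.pos hs.lt_one
      (sub_pos.2 (hs.order_lt i hi)) (hs.memC i hi) (hs.continuousOn hi) hη
  obtain ⟨l, hl⟩ := ((Filter.eventually_all_finset _).2 h1).exists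
  refine ⟨l, fun p M hp hM0 hM t ht => ?_⟩
  have hE : 0 ≤ M * t ^ (-γ) * Real.exp (l * t) :=
    mul_nonneg (mul_nonneg hM0 (Real.rpow_nonneg ht.1.le _)) (Real.exp_pos _).le
  have h2 := (Finset.abs_sum_le_sum_abs _ _).trans
    (Finset.sum_le_sum fun i hi => hl i hi p M hp hM0 hM t ht)
  rw [Finset.sum_const, Nat.card_Icc, add_tsub_cancel_right, nsmul_eq_mul] at h2
  refine h2.trans ?_
  have h3 : (m : ℝ) * (1 / (2 * (m + 1))) ≤ 1 / 2 := by
    rw [mul_one_div, div_le_div_iff₀ (by positivity) (by norm_num)]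
    linarith
  calc _ = (m : ℝ) * (1 / (2 * (m + 1))) * (M * t ^ (-γ) * Real.exp (l * t)) := by ring
    _ ≤ 1 / 2 * (M * t ^ (-γ) * Real.exp (l * t)) := mul_le_mul_of_nonneg_right h3 hE
    _ = _ := by ring

theorem memC_iterate_opD (hs : IsVolterraSystem γ T m α a a') {p : ℝ → ℝ} (hp : MemC γ T p)
    (k : ℕ) : MemC γ T ((opD m α a a')^[k] p) := by
  induction k with
  | zero => exact hp
  | succ k ih =>
    rw [Function.iterate_succ_apply']
    exact hs.memC_opD ih

theorem exists_iterate_opD_bound (hs : IsVolterraSystem γ T m α a a') {p : ℝ → ℝ}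
    (hp : MemC γ T p) :
    ∃ C, 0 ≤ C ∧ ∀ k, ∀ t ∈ Ioc 0 T,
      |(opD m α a a')^[k] p t| ≤ C * (1 / 2) ^ k * t ^ (-γ) := by
  obtain ⟨l, hl⟩ := hs.exists_contraction_opD
  obtain ⟨C, hC0, hC⟩ := hp.exists_bound hs.pos
  have hb : ∀ k, ∀ t ∈ Ioc 0 T, |(opD m α a a')^[k] p t| ≤
      (C * Real.exp (|l| * T)) * (1 / 2) ^ k * t ^ (-γ) * Real.exp (l * t) := by
    intro k
    induction k with
    | zero =>
      intro t ht
      have h1 : 1 ≤ Real.exp (|l| * T) * Real.exp (l * t) := by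
        rw [← Real.exp_add]
        refine Real.one_le_exp ?_
        have h2 : -(|l| * t) ≤ l * t := by
          rw [← neg_mul]
          exact mul_le_mul_of_nonneg_right (neg_abs_le l) ht.1.le
        have h3 := mul_le_mul_of_nonneg_left ht.2 (abs_nonneg l)
        linarith
      refine (hC t ht).trans ?_
      calc C * t ^ (-γ) ≤ C * t ^ (-γ) * (Real.exp (|l| * T) * Real.exp (l * t)) :=
            le_mul_of_one_le_right (mul_nonneg hC0 (Real.rpow_nonneg ht.1.le _)) h1
        _ = _ := by ring
    | succ k ih =>
      intro t ht
      rw [Function.iterate_succ_apply']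
      refine (hl _ _ (hs.memC_iterate_opD hp k) (by positivity) ih t ht).trans_eq ?_
      rw [pow_succ]
      ring
  refine ⟨C * Real.exp (|l| * T) * Real.exp (|l| * T), by positivity, fun k t ht =>
    (hb k t ht).trans ?_⟩
  have h1 : Real.exp (l * t) ≤ Real.exp (|l| * T) :=
    Real.exp_le_exp.2 (mul_le_mul (le_abs_self l) ht.2 ht.1.le (abs_nonneg l))
  have h2 : 0 ≤ C * Real.exp (|l| * T) * (1 / 2) ^ k * t ^ (-γ) :=
    mul_nonneg (by positivity) (Real.rpow_nonneg ht.1.le _)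
  refine (mul_le_mul_of_nonneg_left h1 h2).trans_eq ?_
  ring

theorem eq_zero_of_eq_neg_opL (hs : IsVolterraSystem γ T m α a a') {v : ℝ → ℝ}
    (hv : MemC 0 T v) (heq : ∀ t ∈ Ioo 0 T, v t = -opL m α a v t) {t : ℝ} (ht : t ∈ Ioo 0 T) :
    v t = 0 := by
  have hη : (0 : ℝ) < 1 / (2 * (m + 1)) := by positivity
  have h1 : ∀ i ∈ Finset.Icc 1 m, _ := fun i hi =>
    eventually_mul_rlIntegral_le hs.pos (sub_pos.2 (hs.order_lt i hi)) (hs.continuousOn hi) hη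
  obtain ⟨l, hl, hl0⟩ :=
    (((Filter.eventually_all_finset _).2 h1).and (eventually_ge_atTop 0)).exists
  obtain ⟨C, hC0, hC⟩ := hv.exists_bound hs.pos
  have hb : ∀ k : ℕ, ∀ t ∈ Ioo 0 T, |v t| ≤ C * (1 / 2) ^ k * Real.exp (l * t) := by
    intro k
    induction k with
    | zero =>
      intro t ht
      have h2 := hC t ⟨ht.1, ht.2.le⟩
      rw [neg_zero, Real.rpow_zero, mul_one] at h2
      rw [pow_zero, mul_one]
      exact h2.trans (le_mul_of_one_le_right hC0
        (Real.one_le_exp (mul_nonneg hl0 ht.1.le)))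
    | succ k ih =>
      intro t ht
      have hE : 0 ≤ C * (1 / 2) ^ k * Real.exp (l * t) := by positivity
      rw [heq t ht, abs_neg]
      have h2 := (Finset.abs_sum_le_sum_abs _ _).trans
        (Finset.sum_le_sum fun i hi => hl i hi v (C * (1 / 2) ^ k) (by positivity) ih t ht)
      rw [Finset.sum_const, Nat.card_Icc, add_tsub_cancel_right, nsmul_eq_mul] at h2
      refine h2.trans ?_
      have h3 : (m : ℝ) * (1 / (2 * (m + 1))) ≤ 1 / 2 := by
        rw [mul_one_div, div_le_div_iff₀ (by positivity) (by norm_num)]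
        linarith
      calc _ = (m : ℝ) * (1 / (2 * (m + 1))) * (C * (1 / 2) ^ k * Real.exp (l * t)) := by ring
        _ ≤ 1 / 2 * (C * (1 / 2) ^ k * Real.exp (l * t)) := mul_le_mul_of_nonneg_right h3 hE
        _ = _ := by ring
  have h4 : Tendsto (fun k : ℕ => C * (1 / 2 : ℝ) ^ k * Real.exp (l * t)) atTop (𝓝 0) := by
    simpa using ((tendsto_pow_atTop_nhds_zero_of_lt_one (by norm_num : (0 : ℝ) ≤ 1 / 2)
      (by norm_num)).const_mul C).mul_const (Real.exp (l * t))
  exact abs_nonpos_iff.1 (ge_of_tendsto' h4 fun k => hb k t ht)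

end IsVolterraSystem

/-- A series in `C_γ[0, T]` dominated by a geometric series. -/
structure IsGeometricSeries (γ T C : ℝ) (s : ℕ → ℝ → ℝ) : Prop where
  pos : 0 < T
  lt_one : γ < 1
  nonneg : 0 ≤ C
  memC : ∀ k, MemC γ T (s k)
  bound : ∀ k, ∀ t ∈ Ioc 0 T, |s k t| ≤ C * (1 / 2) ^ k * t ^ (-γ)

namespace IsGeometricSeries

variable {γ T C : ℝ} {s : ℕ → ℝ → ℝ}

theorem memC_tsum (hs : IsGeometricSeries γ T C s) : MemC γ T fun t => ∑' k, s k t := by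
  choose g hg hgs using hs.memC
  refine ⟨fun t => ∑' k, g k t, continuousOn_tsum (u := fun k => C * (1 / 2) ^ k) hg
    (summable_geometric_two.mul_left C) fun k t ht => ?_, fun t ht => ?_⟩
  · rw [← closure_Ioc hs.pos.ne] at ht
    refine le_on_closure (f := fun t => ‖g k t‖) (g := fun _ => C * (1 / 2) ^ k)
      (fun x hx => ?_) ?_ continuousOn_const ht
    · have h1 := hs.bound k x hx
      rw [← hgs k x hx, Real.norm_eq_abs, abs_mul, abs_of_nonneg (Real.rpow_nonneg hx.1.le _)]
      refine (mul_le_mul_of_nonneg_left h1 (Real.rpow_nonneg hx.1.le _)).trans_eq ?_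
      rw [mul_left_comm, ← Real.rpow_add hx.1, add_neg_cancel, Real.rpow_zero, mul_one]
    · rw [closure_Ioc hs.pos.ne]
      exact (hg k).norm
  · rw [← tsum_mul_left]
    exact tsum_congr fun k => hgs k t ht

theorem memC_partial (hs : IsGeometricSeries γ T C s) (N : ℕ) :
    MemC γ T fun t => ∑ k ∈ Finset.range N, s k t :=
  MemC.sum fun k _ => hs.memC k

theorem abs_tsum_sub_le (hs : IsGeometricSeries γ T C s) (N : ℕ) {t : ℝ} (ht : t ∈ Ioc 0 T) :
    |(∑' k, s k t) - ∑ k ∈ Finset.range N, s k t| ≤ 2 * C * (1 / 2) ^ N * t ^ (-γ) := by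
  have hg := summable_geometric_two.mul_left (C * t ^ (-γ))
  have hb : ∀ k, ‖s k t‖ ≤ C * t ^ (-γ) * (1 / 2) ^ k := fun k =>
    (hs.bound k t ht).trans_eq (by ring)
  have hsum : Summable fun k => s k t := Summable.of_norm_bounded hg hb
  rw [← hsum.sum_add_tsum_nat_add N, add_sub_cancel_left]
  have h1 := tsum_of_norm_bounded (f := fun k => s (k + N) t)
    ((hasSum_geometric_two).mul_left (C * t ^ (-γ) * (1 / 2) ^ N)) fun k =>
      (hb (k + N)).trans_eq (by rw [pow_add]; ring)
  refine h1.trans_eq ?_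
  ring

theorem abs_rlIntegral_tsum_sub_le (hs : IsGeometricSeries γ T C s) {b : ℝ} (hb : 0 < b) (N : ℕ)
    {t : ℝ} (ht : t ∈ Ioc 0 T) :
    |rlIntegral b (fun t => ∑' k, s k t) t - ∑ k ∈ Finset.range N, rlIntegral b (s k) t| ≤
      2 * C * (1 / 2) ^ N * kernelConst b γ * t ^ (b - γ) := by
  have ht' : t ∈ Icc 0 T := ⟨ht.1.le, ht.2⟩
  rw [← rlIntegral_sum hb.le hs.lt_one (fun k _ => hs.memC k) ht',
    ← rlIntegral_sub hb.le hs.lt_one hs.memC_tsum (hs.memC_partial N) ht']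
  exact abs_rlIntegral_le hb hs.lt_one ht fun x hx => hs.abs_tsum_sub_le N hx

theorem hasSum_rlIntegral (hs : IsGeometricSeries γ T C s) {b : ℝ} (hb : 0 < b)
    {t : ℝ} (ht : t ∈ Icc 0 T) :
    HasSum (fun k => rlIntegral b (s k) t) (rlIntegral b (fun t => ∑' k, s k t) t) := by
  rcases ht.1.eq_or_lt with rfl | h0
  · simp only [rlIntegral_at_zero hb]
    exact hasSum_zero
  have ht' : t ∈ Ioc 0 T := ⟨h0, ht.2⟩
  have hsum : Summable fun k => rlIntegral b (s k) t :=
    Summable.of_norm_bounded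
      (summable_geometric_two.mul_left (C * kernelConst b γ * t ^ (b - γ))) fun k =>
      (abs_rlIntegral_le hb hs.lt_one ht' (hs.bound k)).trans_eq (by ring)
  rw [hsum.hasSum_iff_tendsto_nat, tendsto_iff_norm_sub_tendsto_zero]
  have h1 : Tendsto (fun N : ℕ => 2 * C * (1 / 2 : ℝ) ^ N * kernelConst b γ * t ^ (b - γ)) atTop
      (𝓝 0) := by
    simpa using (((tendsto_pow_atTop_nhds_zero_of_lt_one (by norm_num : (0 : ℝ) ≤ 1 / 2)
      (by norm_num)).const_mul (2 * C)).mul_const (kernelConst b γ)).mul_const (t ^ (b - γ))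
  refine squeeze_zero (fun _ => norm_nonneg _) (fun N => ?_) h1
  rw [norm_sub_rev]
  exact hs.abs_rlIntegral_tsum_sub_le hb N ht'

end IsGeometricSeries

/-- Successive approximations for `u = -F - opL u`, where `F` is the integral of `p`. -/
theorem IsVolterraSystem.exists_series {γ T : ℝ} {m : ℕ} {α : ℕ → ℝ} {a a' : ℕ → ℝ → ℝ}
    (hs : IsVolterraSystem γ T m α a a') {p F : ℝ → ℝ} (hp : MemC γ T p)
    (hF : ∀ t ∈ Icc 0 T, F t = rlIntegral 1 p t) :
    ∃ (C : ℝ) (s : ℕ → ℝ → ℝ), IsGeometricSeries γ T C s ∧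
      (∀ k, ∀ t ∈ Icc 0 T, (-1) ^ (k + 1) * (opL m α a)^[k] F t = rlIntegral 1 (s k) t) ∧
      ∀ t ∈ Icc 0 T, rlIntegral 1 (fun t => ∑' k, s k t) t =
        -F t - opL m α a (rlIntegral 1 fun t => ∑' k, s k t) t := by
  obtain ⟨C, hC0, hC⟩ := hs.exists_iterate_opD_bound hp
  set s : ℕ → ℝ → ℝ := fun k t => (-1) ^ (k + 1) * (opD m α a a')^[k] p t with hsdef
  have hg : IsGeometricSeries γ T C s :=
    { pos := hs.pos
      lt_one := hs.lt_one
      nonneg := hC0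
      memC := fun k => (hs.memC_iterate_opD hp k).const_mul _
      bound := fun k t ht => by
        have h1 := hC k t ht
        simpa [hsdef, abs_mul] using h1 }
  refine ⟨C, s, hg, ?_, fun t ht => ?_⟩
  · have hiter : ∀ k, ∀ t ∈ Icc 0 T,
        (opL m α a)^[k] F t = rlIntegral 1 ((opD m α a a')^[k] p) t := by
      intro k
      induction k with
      | zero => exact hF
      | succ k ih =>
        intro t ht
        rw [Function.iterate_succ_apply', Function.iterate_succ_apply']
        exact hs.opL_eq_rlIntegral_one (hs.memC_iterate_opD hp k) ih ht
    intro k t ht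
    rw [hiter k t ht, ← rlIntegral_const_mul]
  · have h1 := hg.hasSum_rlIntegral one_pos ht
    have h2 := (hasSum_nat_add_iff' 1).2 h1
    have h3 : rlIntegral 1 (s 0) t = -F t := by
      have : s 0 = fun t => (-1) * p t := by
        ext x
        simp [hsdef]
      rw [this, rlIntegral_const_mul, hF t ht, neg_one_mul]
    have h4 : HasSum (fun k => opL m α a (rlIntegral 1 (s k)) t)
        (opL m α a (rlIntegral 1 fun t => ∑' k, s k t) t) := by
      refine hasSum_sum fun i hi => HasSum.mul_left _ ?_
      have hε := sub_pos.2 (hs.order_lt i hi)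
      have h5 := hg.hasSum_rlIntegral (add_pos hε one_pos) ht
      rw [rlIntegral_rlIntegral hε.le zero_le_one hs.lt_one hg.memC_tsum ht]
      exact h5.congr_fun fun k => rlIntegral_rlIntegral hε.le zero_le_one hs.lt_one (hg.memC k) ht
    have h6 : ∀ k, opL m α a (rlIntegral 1 (s k)) t = -rlIntegral 1 (s (k + 1)) t := by
      intro k
      rw [hs.opL_eq_rlIntegral_one (hg.memC k) (fun _ _ => rfl) ht]
      have h7 : s (k + 1) = fun t => (-1) * opD m α a a' (s k) t := by
        ext x
        simp only [hsdef]
        rw [opD_const_mul, Function.iterate_succ_apply', pow_succ _ (k + 1)]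
        ring
      rw [h7, rlIntegral_const_mul, neg_one_mul, neg_neg]
    simp only [h6] at h4
    have h8 := h4.neg
    simp only [neg_neg] at h8
    have h9 := h2.unique h8
    rw [Finset.sum_range_one, h3] at h9
    linarith

theorem eqOn_iteratedDerivWithin {T : ℝ} (hT : 0 < T) {f : ℝ → ℝ} {g : ℕ → ℝ → ℝ} {n : ℕ}
    (h0 : EqOn f (g 0) (Icc 0 T))
    (hg : ∀ k < n, ∀ t ∈ Icc 0 T, HasDerivWithinAt (g k) (g (k + 1) t) (Icc 0 T) t) :
    ∀ k ≤ n, EqOn (iteratedDerivWithin k f (Icc 0 T)) (g k) (Icc 0 T) := by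
  intro k
  induction k with
  | zero => exact fun _ t ht => by rw [iteratedDerivWithin_zero, h0 ht]
  | succ k ih =>
    intro hk t ht
    have h1 := ih (by omega)
    rw [iteratedDerivWithin_succ]
    exact ((hg k (by omega) t ht).congr h1 (h1 ht)).derivWithin (uniqueDiffOn_Icc hT t ht)

theorem contDiffOn_of_derivatives {T : ℝ} (hT : 0 < T) {f : ℝ → ℝ} {g : ℕ → ℝ → ℝ} {n : ℕ}
    (h0 : EqOn f (g 0) (Icc 0 T))
    (hg : ∀ k < n, ∀ t ∈ Icc 0 T, HasDerivWithinAt (g k) (g (k + 1) t) (Icc 0 T) t)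
    (hn : ContinuousOn (g n) (Icc 0 T)) : ContDiffOn ℝ n f (Icc 0 T) := by
  have h1 := eqOn_iteratedDerivWithin hT h0 hg
  rw [contDiffOn_nat_iff_continuousOn_differentiableOn_deriv (uniqueDiffOn_Icc hT)]
  refine ⟨fun k hk => ?_, fun k hk t ht => ?_⟩
  · refine ContinuousOn.congr ?_ (h1 k hk)
    rcases hk.eq_or_lt with rfl | hk
    · exact hn
    · exact fun t ht => (hg k hk t ht).continuousWithinAt
  · exact ((hg k hk t ht).congr (h1 k hk.le) (h1 k hk.le ht)).differentiableWithinAt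

theorem memCn_of_derivatives {γ T : ℝ} (hT : 0 < T) {f : ℝ → ℝ} {g : ℕ → ℝ → ℝ} {n : ℕ}
    (h0 : EqOn f (g 0) (Icc 0 T))
    (hg : ∀ k < n, ∀ t ∈ Icc 0 T, HasDerivWithinAt (g k) (g (k + 1) t) (Icc 0 T) t)
    (hn : ContinuousOn (g n) (Icc 0 T))
    (hgn : ∀ t ∈ Ioc 0 T, HasDerivWithinAt (g n) (g (n + 1) t) (Icc 0 T) t)
    (hC : MemC γ T (g (n + 1))) :
    MemCn γ T (n + 1) f ∧
      EqOn (iteratedDerivWithin (n + 1) f (Icc 0 T)) (g (n + 1)) (Ioc 0 T) := by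
  have h1 := eqOn_iteratedDerivWithin hT h0 hg n le_rfl
  have h2 : ∀ t ∈ Ioc 0 T,
      HasDerivWithinAt (iteratedDerivWithin n f (Icc 0 T)) (g (n + 1) t) (Icc 0 T) t :=
    fun t ht => (hgn t ht).congr h1 (h1 ⟨ht.1.le, ht.2⟩)
  have h3 : EqOn (iteratedDerivWithin (n + 1) f (Icc 0 T)) (g (n + 1)) (Ioc 0 T) := by
    intro t ht
    rw [iteratedDerivWithin_succ]
    exact (h2 t ht).derivWithin (uniqueDiffOn_Icc hT t ⟨ht.1.le, ht.2⟩)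
  exact ⟨⟨contDiffOn_of_derivatives hT h0 hg hn, fun t ht => (h2 t ht).differentiableWithinAt,
    hC.congr h3⟩, h3⟩

theorem eqOn_iteratedDeriv {T : ℝ} {f : ℝ → ℝ} {g : ℕ → ℝ → ℝ} {n : ℕ}
    (h0 : EqOn f (g 0) (Ioo 0 T))
    (hg : ∀ k < n, ∀ t ∈ Ioo 0 T, HasDerivAt (g k) (g (k + 1) t) t) :
    ∀ k ≤ n, EqOn (iteratedDeriv k f) (g k) (Ioo 0 T) := by
  intro k
  induction k with
  | zero => exact fun _ t ht => by rw [iteratedDeriv_zero, h0 ht]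
  | succ k ih =>
    intro hk t ht
    have h1 := ih (by omega)
    rw [iteratedDeriv_succ]
    exact ((hg k (by omega) t ht).congr_of_eventuallyEq
      (h1.eventuallyEq_of_mem (Ioo_mem_nhds ht.1 ht.2))).deriv

/-- The `k`-th derivative of `t^j / j!`. -/
def monomialDeriv (j k : ℕ) (t : ℝ) : ℝ :=
  if k ≤ j then t ^ (j - k) / ((j - k).factorial : ℝ) else 0

theorem monomialDeriv_zero (j : ℕ) (t : ℝ) : monomialDeriv j 0 t = Phi ((j : ℝ) + 1) t := by
  rw [Phi_natCast_add_one, monomialDeriv, if_pos (Nat.zero_le j), Nat.sub_zero]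

theorem monomialDeriv_of_lt {j k : ℕ} (hjk : j < k) (t : ℝ) : monomialDeriv j k t = 0 :=
  if_neg hjk.not_ge

theorem monomialDeriv_at_zero (j k : ℕ) :
    monomialDeriv j k 0 = if j = k then 1 else 0 := by
  unfold monomialDeriv
  rcases lt_trichotomy j k with h | h | h
  · rw [if_neg h.not_ge, if_neg h.ne]
  · subst h
    simp
  · rw [if_pos h.le, if_neg h.ne', zero_pow (Nat.sub_pos_of_lt h).ne', zero_div]

theorem hasDerivAt_monomialDeriv (j k : ℕ) (t : ℝ) :
    HasDerivAt (monomialDeriv j k) (monomialDeriv j (k + 1) t) t := by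
  rcases lt_trichotomy j k with h | h | h
  · have h1 : monomialDeriv j k = fun _ => 0 := funext fun s => monomialDeriv_of_lt h s
    rw [h1, monomialDeriv_of_lt (by omega)]
    exact hasDerivAt_const t 0
  · subst h
    have h1 : monomialDeriv j j = fun _ => 1 := funext fun s => by simp [monomialDeriv]
    rw [h1, monomialDeriv_of_lt (by omega)]
    exact hasDerivAt_const t 1
  · obtain ⟨d, rfl⟩ := Nat.exists_eq_add_of_lt h
    have h1 : monomialDeriv (k + d + 1) k = fun s => s ^ (d + 1) / ((d + 1).factorial : ℝ) :=
      funext fun s => by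
        rw [monomialDeriv, if_pos (by omega), show k + d + 1 - k = d + 1 by omega]
    have h2 : monomialDeriv (k + d + 1) (k + 1) t = t ^ d / (d.factorial : ℝ) := by
      rw [monomialDeriv, if_pos (by omega), show k + d + 1 - (k + 1) = d by omega]
    rw [h1, h2]
    convert! (hasDerivAt_pow (d + 1) t).div_const ((d + 1).factorial : ℝ) using 1
    rw [Nat.factorial_succ, Nat.add_sub_cancel, Nat.cast_mul,
      mul_div_mul_left _ _ (Nat.cast_ne_zero.2 d.succ_ne_zero)]

theorem continuous_monomialDeriv (j k : ℕ) : Continuous (monomialDeriv j k) :=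
  continuous_iff_continuousAt.2 fun t => (hasDerivAt_monomialDeriv j k t).continuousAt

/-- Derivatives of `t^j / j! + I^(n + 2 - γ) p` for `p ∈ C_γ[0, T]`. -/
theorem memCn_monomial_add_rlIntegral {γ T : ℝ} {f p : ℝ → ℝ} {n j : ℕ} (hT : 0 < T)
    (hγ : γ < 1) (hj : j ≤ n) (hp : MemC γ T p)
    (hf : ∀ t ∈ Icc 0 T, f t = Phi ((j : ℝ) + 1) t + rlIntegral ((n : ℝ) + 2 - γ) p t) :
    MemCn γ T (n + 1) f ∧
      (∀ k ≤ n, EqOn (iteratedDerivWithin k f (Icc 0 T))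
        (fun t => monomialDeriv j k t + rlIntegral ((n : ℝ) + 2 - γ - k) p t) (Icc 0 T)) ∧
      EqOn (iteratedDerivWithin (n + 1) f (Icc 0 T))
        (rlIntegral (1 - γ) p) (Ioc 0 T) := by
  have hlast : (n : ℝ) + 2 - γ - ((n + 1 : ℕ) : ℝ) = 1 - γ := by
    push_cast
    ring
  have hstep : ∀ k : ℕ, (n : ℝ) + 2 - γ - ((k + 1 : ℕ) : ℝ) + 1 = (n : ℝ) + 2 - γ - k := by
    intro k
    push_cast
    ring
  set g : ℕ → ℝ → ℝ := fun k t =>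
    monomialDeriv j k t + rlIntegral ((n : ℝ) + 2 - γ - k) p t with hg
  have h0 : EqOn f (g 0) (Icc 0 T) := fun t ht => by
    rw [hf t ht, hg]
    simp only [monomialDeriv_zero, Nat.cast_zero, sub_zero]
  have hd : ∀ k < n, ∀ t ∈ Icc 0 T, HasDerivWithinAt (g k) (g (k + 1) t) (Icc 0 T) t := by
    intro k hk t ht
    have hk' : ((k + 1 : ℕ) : ℝ) ≤ n := Nat.cast_le.2 hk
    have h1 := hasDerivWithinAt_rlIntegral_Icc
      (b := (n : ℝ) + 2 - γ - ((k + 1 : ℕ) : ℝ)) (by linarith) hγ (by linarith) hp hT ht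
    rw [hstep] at h1
    exact (hasDerivAt_monomialDeriv j k t).hasDerivWithinAt.add h1
  have hdn : ∀ t ∈ Ioc 0 T, HasDerivWithinAt (g n) (g (n + 1) t) (Icc 0 T) t := by
    intro t ht
    have h1 := hasDerivWithinAt_rlIntegral
      (b := (n : ℝ) + 2 - γ - ((n + 1 : ℕ) : ℝ)) (by linarith) hγ hp ht
    rw [hstep] at h1
    exact (hasDerivAt_monomialDeriv j n t).hasDerivWithinAt.add h1
  have hc : ContinuousOn (g n) (Icc 0 T) :=
    (continuous_monomialDeriv j n).continuousOn.add
      (hp.continuousOn_rlIntegral (by linarith) hγ hT (by linarith))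
  have hC : MemC γ T (g (n + 1)) :=
    ((memC_zero_fun γ T).congr fun t _ => monomialDeriv_of_lt (by omega) t).add
      (hp.rlIntegral (by linarith) hγ hT (by linarith))
  obtain ⟨h1, h2⟩ := memCn_of_derivatives hT h0 hd hc hdn hC
  refine ⟨h1, eqOn_iteratedDerivWithin hT h0 hd, fun t ht => ?_⟩
  rw [h2 ht, hg]
  simp only [hlast, monomialDeriv_of_lt (Nat.lt_succ_of_le hj), zero_add]

theorem tendstoUniformlyOn_of_geometric_bound {F : ℕ → ℝ → ℝ} {f : ℝ → ℝ} {S : Set ℝ} {K : ℝ}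
    (h : ∀ N, ∀ t ∈ S, |f t - F N t| ≤ K * (1 / 2) ^ N) : TendstoUniformlyOn F f atTop S := by
  have h1 : Tendsto (fun N : ℕ => K * (1 / 2 : ℝ) ^ N) atTop (𝓝 0) := by
    simpa using (tendsto_pow_atTop_nhds_zero_of_lt_one (by norm_num : (0 : ℝ) ≤ 1 / 2)
      (by norm_num)).const_mul K
  rw [Metric.tendstoUniformlyOn_iff]
  intro e he
  filter_upwards [h1.eventually_lt_const he] with N hN t ht
  exact (h N t ht).trans_lt hN

theorem IsGeometricSeries.abs_rlIntegral_tsum_sub_le_Icc {γ T C : ℝ} {s : ℕ → ℝ → ℝ}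
    (hs : IsGeometricSeries γ T C s) {b : ℝ} (hb : 0 < b) (hbγ : γ ≤ b) (N : ℕ)
    {t : ℝ} (ht : t ∈ Icc 0 T) :
    |rlIntegral b (fun t => ∑' k, s k t) t - rlIntegral b (fun t => ∑ k ∈ Finset.range N, s k t) t|
      ≤ 2 * C * kernelConst b γ * T ^ (b - γ) * (1 / 2) ^ N := by
  have hC := hs.nonneg
  have hk := kernelConst_nonneg hb γ
  have hT := Real.rpow_nonneg hs.pos.le (b - γ)
  rcases ht.1.eq_or_lt with rfl | h0
  · rw [rlIntegral_at_zero hb, rlIntegral_at_zero hb, sub_zero, abs_zero]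
    positivity
  · rw [rlIntegral_sum hb.le hs.lt_one (fun k _ => hs.memC k) ht]
    refine (hs.abs_rlIntegral_tsum_sub_le hb N ⟨h0, ht.2⟩).trans ?_
    have h1 := Real.rpow_le_rpow h0.le ht.2 (sub_nonneg.2 hbγ)
    calc _ ≤ 2 * C * (1 / 2) ^ N * kernelConst b γ * T ^ (b - γ) :=
          mul_le_mul_of_nonneg_left h1 (by positivity)
      _ = _ := by ring

theorem IsGeometricSeries.convergesInCn {γ T C : ℝ} {s F : ℕ → ℝ → ℝ} {f : ℝ → ℝ} {n j : ℕ}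
    (hs : IsGeometricSeries γ T C s) (hγ0 : 0 < γ) (hj : j ≤ n)
    (hf : ∀ t ∈ Icc 0 T, f t = Phi ((j : ℝ) + 1) t +
      rlIntegral ((n : ℝ) + 2 - γ) (fun t => ∑' k, s k t) t)
    (hF : ∀ N, ∀ t ∈ Icc 0 T, F N t = Phi ((j : ℝ) + 1) t +
      rlIntegral ((n : ℝ) + 2 - γ) (fun t => ∑ k ∈ Finset.range N, s k t) t) :
    ConvergesInCn γ T (n + 1) F f := by
  obtain ⟨h1, h2, h3⟩ :=
    memCn_monomial_add_rlIntegral hs.pos hs.lt_one hj hs.memC_tsum hf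
  have hFN := fun N =>
    memCn_monomial_add_rlIntegral hs.pos hs.lt_one hj (hs.memC_partial N) (hF N)
  have hγ1 := hs.lt_one
  have hC := hs.nonneg
  refine ⟨fun N => (hFN N).1, h1, fun k hk => ?_, ?_⟩
  · have hk' : (k : ℝ) ≤ n := Nat.cast_le.2 (Nat.lt_succ_iff.1 hk)
    refine tendstoUniformlyOn_of_geometric_bound (K := 2 * C *
      kernelConst ((n : ℝ) + 2 - γ - k) γ * T ^ ((n : ℝ) + 2 - γ - k - γ)) fun N t ht => ?_
    rw [h2 k (Nat.lt_succ_iff.1 hk) ht, (hFN N).2.1 k (Nat.lt_succ_iff.1 hk) ht]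
    simp only [add_sub_add_left_eq_sub]
    exact hs.abs_rlIntegral_tsum_sub_le_Icc (by linarith) (by linarith) N ht
  · refine tendstoUniformlyOn_of_geometric_bound
      (K := 2 * C * kernelConst (1 - γ) γ * T ^ (1 - γ)) fun N t ht => ?_
    have hb : 0 < 1 - γ := by linarith
    have hk := kernelConst_nonneg hb γ
    rw [h3 ht, (hFN N).2.2 ht, ← mul_sub, abs_mul, abs_of_nonneg (Real.rpow_nonneg ht.1.le _),
      rlIntegral_sum hb.le hs.lt_one (fun k _ => hs.memC k) ⟨ht.1.le, ht.2⟩]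
    refine (mul_le_mul_of_nonneg_left (hs.abs_rlIntegral_tsum_sub_le hb N ht)
      (Real.rpow_nonneg ht.1.le _)).trans ?_
    have h4 : t ^ γ * t ^ (1 - γ - γ) ≤ T ^ (1 - γ) := by
      rw [← Real.rpow_add ht.1, add_sub_cancel]
      exact Real.rpow_le_rpow ht.1.le ht.2 hb.le
    calc _ = 2 * C * (1 / 2) ^ N * kernelConst (1 - γ) γ * (t ^ γ * t ^ (1 - γ - γ)) := by ring
      _ ≤ 2 * C * (1 / 2) ^ N * kernelConst (1 - γ) γ * T ^ (1 - γ) :=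
          mul_le_mul_of_nonneg_left h4 (by positivity)
      _ = _ := by ring

/-- The Caputo derivatives of `t^j / j! + I^(α₀) u`. -/
theorem caputo_of_eq_Phi_add_rlIntegral {T α₀ β : ℝ} {j : ℕ} {f u : ℝ → ℝ}
    (hβ : 0 ≤ β) (hβα : β ≤ α₀) (hu : MemC 0 T u)
    (hf : ∀ t ∈ Ioc 0 T, f t = Phi ((j : ℝ) + 1) t + rlIntegral α₀ u t)
    (h0 : ∀ k < ⌈β⌉₊, iteratedDerivWithin k f (Icc 0 T) 0 = if j = k then 1 else 0) :
    CaputoDifferentiable T β f ∧ ∀ t ∈ Ioo 0 T, caputoDeriv T β f t =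
      (if β ≤ j then Phi ((j : ℝ) + 1 - β) t else 0) + rlIntegral (α₀ - β) u t := by
  set n := ⌈β⌉₊ with hn
  set c : ℝ := if β ≤ j then 1 else 0 with hc
  have hnβ : 0 ≤ (n : ℝ) - β := sub_nonneg.2 (Nat.le_ceil β)
  have hα₀ : 0 ≤ α₀ := hβ.trans hβα
  have hR : ∀ t ∈ Ioc 0 T, taylorRemainder T n f t =
      c * Phi ((j : ℝ) + 1) t + rlIntegral α₀ u t := by
    intro t ht
    have h1 : ∑ k ∈ Finset.range n,
        iteratedDerivWithin k f (Icc 0 T) 0 / (k.factorial : ℝ) * t ^ k =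
        (1 - c) * Phi ((j : ℝ) + 1) t := by
      have h2 : ∀ k ∈ Finset.range n,
          iteratedDerivWithin k f (Icc 0 T) 0 / (k.factorial : ℝ) * t ^ k =
          if j = k then t ^ k / (k.factorial : ℝ) else 0 := by
        intro k hk
        rw [h0 k (Finset.mem_range.1 hk)]
        split_ifs <;> ring
      rw [Finset.sum_congr rfl h2, Finset.sum_ite_eq, Phi_natCast_add_one]
      by_cases hj : β ≤ j
      · rw [hc, if_pos hj, if_neg (by rw [Finset.mem_range, not_lt]; exact Nat.ceil_le.2 hj)]
        ring
      · rw [hc, if_neg hj,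
          if_pos (by rw [Finset.mem_range, ← not_le]; exact fun h => hj (Nat.ceil_le.1 h))]
        ring
    rw [taylorRemainder, h1, hf t ht]
    ring
  set g : ℕ → ℝ → ℝ := fun k t => c * Phi ((j : ℝ) + 1 + ((n : ℝ) - β) - k) t +
    rlIntegral ((n : ℝ) - β + α₀ - k) u t with hg
  have hg0 : EqOn (rlIntegral ((n : ℝ) - β) (taylorRemainder T n f)) (g 0) (Ioo 0 T) := by
    intro t ht
    have hT := ht.1.trans ht.2
    have ht' : t ∈ Icc 0 T := ⟨ht.1.le, ht.2.le⟩
    have hj1 : (1 : ℝ) ≤ (j : ℝ) + 1 := by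
      have : (0 : ℝ) ≤ j := Nat.cast_nonneg j
      linarith
    have h1 : MemC 0 T (Phi ((j : ℝ) + 1)) := (memC_Phi _ T).mono (by linarith)
    rw [rlIntegral_congr_Ioc hnβ ⟨ht.1, ht.2.le⟩ hR,
      rlIntegral_add hnβ one_pos (h1.const_mul c)
        (hu.rlIntegral hα₀ one_pos hT (by linarith)) ht',
      rlIntegral_const_mul, rlIntegral_Phi hnβ (by linarith) ht.1,
      rlIntegral_rlIntegral hnβ hα₀ one_pos hu ht', hg]
    simp only [Nat.cast_zero, sub_zero]
    rw [add_comm ((n : ℝ) - β) ((j : ℝ) + 1)]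
  have hgd : ∀ k < n, ∀ t ∈ Ioo 0 T, HasDerivAt (g k) (g (k + 1) t) t := by
    intro k hk t ht
    have hk' : ((k + 1 : ℕ) : ℝ) ≤ n := Nat.cast_le.2 hk
    have h1 := (hasDerivAt_Phi' (β := (j : ℝ) + 1 + ((n : ℝ) - β) - k) ht.1).const_mul c
    have h2 := hasDerivAt_rlIntegral (b := (n : ℝ) - β + α₀ - ((k + 1 : ℕ) : ℝ))
      (by linarith) one_pos hu ht
    have e1 : (j : ℝ) + 1 + ((n : ℝ) - β) - k - 1 =
        (j : ℝ) + 1 + ((n : ℝ) - β) - ((k + 1 : ℕ) : ℝ) := by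
      push_cast
      ring
    have e2 : (n : ℝ) - β + α₀ - ((k + 1 : ℕ) : ℝ) + 1 = (n : ℝ) - β + α₀ - k := by
      push_cast
      ring
    rw [e1] at h1
    rw [e2] at h2
    exact h1.add h2
  have h1 := eqOn_iteratedDeriv hg0 hgd
  refine ⟨fun k hk t ht => ?_, fun t ht => ?_⟩
  · exact ((hgd k hk t ht).congr_of_eventuallyEq ((h1 k hk.le).eventuallyEq_of_mem
      (Ioo_mem_nhds ht.1 ht.2))).differentiableAt.differentiableWithinAt
  · refine (h1 n le_rfl ht).trans ?_
    simp only [hg]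
    congr 1
    · rw [show (j : ℝ) + 1 + ((n : ℝ) - β) - n = (j : ℝ) + 1 - β by ring, hc, ite_mul, one_mul,
        zero_mul]
    · rw [show (n : ℝ) - β + α₀ - n = α₀ - β by ring]

/-- Taylor's formula at zero with integral remainder. -/
theorem MemCn.eq_Phi_add_rlIntegral {γ T : ℝ} {z : ℝ → ℝ} {n j : ℕ} (hT : 0 < T) (hγ0 : 0 ≤ γ)
    (hγ : γ < 1) (hj : j ≤ n) (hz : MemCn γ T (n + 1) z)
    (h0 : ∀ k ≤ n, iteratedDerivWithin k z (Icc 0 T) 0 = if j = k then 1 else 0)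
    {t : ℝ} (ht : t ∈ Icc 0 T) :
    z t = Phi ((j : ℝ) + 1) t +
      rlIntegral ((n : ℝ) + 1) (iteratedDerivWithin (n + 1) z (Icc 0 T)) t := by
  obtain ⟨hz1, hz2, hz3⟩ := hz
  rw [contDiffOn_nat_iff_continuousOn_differentiableOn_deriv (uniqueDiffOn_Icc hT)] at hz1
  set G : ℕ → ℝ → ℝ := fun k t => iteratedDerivWithin k z (Icc 0 T) t - monomialDeriv j k t with hG
  have hGc : ∀ k ≤ n, ContinuousOn (G k) (Icc 0 T) := fun k hk =>
    (hz1.1 k hk).sub (continuous_monomialDeriv j k).continuousOn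
  have hG0 : ∀ k ≤ n, G k 0 = 0 := fun k hk => by
    simp only [hG]
    rw [h0 k hk, monomialDeriv_at_zero, sub_self]
  have hGlast : ∀ t, G (n + 1) t = iteratedDerivWithin (n + 1) z (Icc 0 T) t := fun t => by
    simp only [hG]
    rw [monomialDeriv_of_lt (by omega), sub_zero]
  have hGm : ∀ k ≤ n + 1, MemC γ T (G k) := by
    intro k hk
    rcases hk.eq_or_lt with rfl | hk
    · exact hz3.congr fun t _ => hGlast t
    · exact (memC_zero_of_continuousOn (hGc k (by omega))).mono hγ0
  have hdiff : ∀ k ≤ n, ∀ t ∈ Ioo 0 T,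
      DifferentiableWithinAt ℝ (iteratedDerivWithin k z (Icc 0 T)) (Icc 0 T) t := by
    intro k hk t ht
    rcases hk.eq_or_lt with rfl | hk
    · exact hz2 t ⟨ht.1, ht.2.le⟩
    · exact hz1.2 k hk t ⟨ht.1.le, ht.2.le⟩
  have hGd : ∀ k ≤ n, ∀ t ∈ Ioo 0 T, HasDerivAt (G k) (G (k + 1) t) t := by
    intro k hk t ht
    have h1 := (hdiff k hk t ht).hasDerivWithinAt.hasDerivAt (Icc_mem_nhds ht.1 ht.2)
    rw [← iteratedDerivWithin_succ] at h1
    exact h1.sub (hasDerivAt_monomialDeriv j k t)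
  have hGint : ∀ k ≤ n, ∀ t ∈ Icc 0 T, G k t = rlIntegral 1 (G (k + 1)) t := fun k hk t ht =>
    eq_rlIntegral_one_of_hasDerivAt hγ (hGm (k + 1) (by omega)) (hGc k hk) (hG0 k hk)
      (hGd k hk) ht
  have hall : ∀ d ≤ n, ∀ t ∈ Icc 0 T, G (n - d) t = rlIntegral ((d : ℝ) + 1) (G (n + 1)) t := by
    intro d
    induction d with
    | zero =>
      intro _ t ht
      simpa using hGint n le_rfl t ht
    | succ d ih =>
      intro hd t ht
      rw [hGint (n - (d + 1)) (by omega) t ht, show n - (d + 1) + 1 = n - d by omega,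
        rlIntegral_congr_Icc one_pos ht fun s hs => ih (by omega) s ⟨hs.1.le, hs.2⟩,
        rlIntegral_rlIntegral zero_le_one (by positivity) hγ (hGm (n + 1) le_rfl) ht]
      congr 1
      push_cast
      ring
  have h1 := hall n le_rfl t ht
  rw [Nat.sub_self] at h1
  simp only [funext hGlast] at h1
  rw [← h1]
  simp only [hG]
  rw [iteratedDerivWithin_zero, monomialDeriv_zero]
  ring

theorem MemCn.one_hasDerivAt {γ T : ℝ} {A : ℝ → ℝ} (hA : MemCn γ T 1 A) {t : ℝ}
    (ht : t ∈ Ioo 0 T) : HasDerivAt A (iteratedDerivWithin 1 A (Icc 0 T) t) t := by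
  have h1 := hA.2.1 t ⟨ht.1, ht.2.le⟩
  rw [iteratedDerivWithin_zero] at h1
  rw [iteratedDerivWithin_one]
  exact h1.hasDerivWithinAt.hasDerivAt (Icc_mem_nhds ht.1 ht.2)

theorem MemCn.one_eq_add_rlIntegral {γ T : ℝ} {A : ℝ → ℝ} (hγ : γ < 1) (hA : MemCn γ T 1 A)
    {t : ℝ} (ht : t ∈ Icc 0 T) :
    A t = A 0 + rlIntegral 1 (iteratedDerivWithin 1 A (Icc 0 T)) t := by
  have h1 := eq_rlIntegral_one_of_hasDerivAt (F := fun t => A t - A 0) hγ hA.2.2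
    (hA.1.continuousOn.sub continuousOn_const) (sub_self _)
    (fun x hx => (hA.one_hasDerivAt hx).sub_const _) ht
  simp only [zero_add] at h1
  linarith

/-- If `D^γ A` extends continuously to zero, then `A(0) = 0`. -/
theorem MemCn.one_eq_zero_of_rlDeriv {γ T : ℝ} {A g : ℝ → ℝ} (hT : 0 < T) (hγ0 : 0 < γ)
    (hγ : γ < 1) (hA : MemCn γ T 1 A) (hg : ContinuousOn g (Icc 0 T))
    (hD : ∀ t ∈ Ioo 0 T, rlDeriv γ A t = g t) : A 0 = 0 := by
  have hceil : ⌈γ⌉₊ = 1 := (Nat.ceil_eq_iff one_ne_zero).2 ⟨by simpa, by simpa using hγ.le⟩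
  have hb : 0 < 1 - γ := by linarith
  have hA' : MemC γ T (iteratedDerivWithin 1 A (Icc 0 T)) := hA.2.2
  have h1 : ∀ t ∈ Ioo 0 T, rlIntegral (1 - γ) A t = A 0 * Phi (1 - γ + 1) t +
      rlIntegral (1 - γ + 1) (iteratedDerivWithin 1 A (Icc 0 T)) t := by
    intro t ht
    have ht' : t ∈ Icc 0 T := ⟨ht.1.le, ht.2.le⟩
    have h2 : ∀ s ∈ Ioc 0 T, A s = A 0 * Phi 1 s +
        rlIntegral 1 (iteratedDerivWithin 1 A (Icc 0 T)) s := by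
      intro s hs
      rw [hA.one_eq_add_rlIntegral hγ ⟨hs.1.le, hs.2⟩]
      simp [Phi]
    rw [rlIntegral_congr_Icc hb ht' h2, rlIntegral_add hb.le hγ
      (((memC_Phi 1 T).mono (by linarith)).const_mul _)
      (hA'.rlIntegral zero_le_one hγ hT (by linarith)) ht', rlIntegral_const_mul,
      rlIntegral_Phi hb.le one_pos ht.1, rlIntegral_rlIntegral hb.le zero_le_one hγ hA' ht']
  obtain ⟨Q, hQ, hQe⟩ := hA'.exists_rlIntegral_rep hb hγ hT
  have h3 : EqOn (fun t => t ^ γ * g t - t ^ (1 - γ) * Q t)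
      (fun _ => A 0 / Real.Gamma (1 - γ)) (Ioo 0 T) := by
    intro t ht
    have h4 : HasDerivAt (rlIntegral (1 - γ) A) (A 0 * Phi (1 - γ + 1 - 1) t +
        rlIntegral (1 - γ) (iteratedDerivWithin 1 A (Icc 0 T)) t) t :=
      (((hasDerivAt_Phi' ht.1).const_mul _).add
        (hasDerivAt_rlIntegral hb.le hγ hA' ht)).congr_of_eventuallyEq
        (EqOn.eventuallyEq_of_mem h1 (Ioo_mem_nhds ht.1 ht.2))
    have h5 := hD t ht
    rw [rlDeriv, hceil, iteratedDeriv_one, Nat.cast_one, h4.deriv, hQe t ⟨ht.1, ht.2.le⟩,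
      Phi] at h5
    have h6 : t ^ γ * t ^ (1 - γ + 1 - 1 - 1) = 1 := by
      rw [← Real.rpow_add ht.1]
      simp
    have h7 : t ^ γ * t ^ (1 - γ - γ) = t ^ (1 - γ) := by
      rw [← Real.rpow_add ht.1]
      ring_nf
    simp only
    rw [← h5, ← h7, add_sub_cancel_right (1 - γ) 1]
    rw [add_sub_cancel_right (1 - γ) 1] at h6
    linear_combination (A 0 / Real.Gamma (1 - γ)) * h6
  have h8 : EqOn (fun t => t ^ γ * g t - t ^ (1 - γ) * Q t)
      (fun _ => A 0 / Real.Gamma (1 - γ)) (Icc 0 T) :=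
    h3.of_subset_closure
      (((Real.continuous_rpow_const hγ0.le).continuousOn.mul hg).sub
        ((Real.continuous_rpow_const hb.le).mul hQ).continuousOn)
      continuousOn_const Ioo_subset_Icc_self (closure_Ioo hT.ne).ge
  have h9 := h8 (left_mem_Icc.2 hT.le)
  simp only [Real.zero_rpow hγ0.ne', Real.zero_rpow hb.ne', zero_mul, sub_zero] at h9
  exact (div_eq_zero_iff.1 h9.symm).resolve_right (Real.Gamma_pos_of_pos hb).ne'

/-- The right-hand side `∑ a_i ᶜD^{α_i} Φ_{j+1}`. -/
def source (m : ℕ) (α : ℕ → ℝ) (a : ℕ → ℝ → ℝ) (j : ℕ) (t : ℝ) : ℝ :=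
  ∑ i ∈ Finset.Icc 1 m, a i t * (if α i ≤ j then Phi ((j : ℝ) + 1 - α i) t else 0)

theorem exists_source_eq_rlIntegral_one {γ T : ℝ} {m : ℕ} {α : ℕ → ℝ} {a a' : ℕ → ℝ → ℝ}
    (hs : IsVolterraSystem γ T m α a a') (j : ℕ) :
    ∃ p, MemC γ T p ∧ ∀ t ∈ Icc 0 T, source m α a j t = rlIntegral 1 p t := by
  have h1 : ∀ i ∈ Finset.Icc 1 m, ∃ p, MemC γ T p ∧ ∀ t ∈ Icc 0 T,
      a i t * (if α i ≤ j then Phi ((j : ℝ) + 1 - α i) t else 0) = rlIntegral 1 p t := by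
    intro i hi
    by_cases hj : α i ≤ j
    · simp only [if_pos hj]
      exact ⟨_, memC_deriv_mul_Phi hs.pos hs.lt_one (hs.memC i hi) (hs.eq_integral i hi)
        (by linarith), fun t ht => mul_Phi_eq_rlIntegral_one hs.pos hs.lt_one (hs.memC i hi)
          (hs.eq_integral i hi) (by linarith) ht⟩
    · exact ⟨fun _ => 0, memC_zero_fun γ T, fun t _ => by
        rw [if_neg hj, mul_zero, rlIntegral_zero_fun]⟩
  choose! p hp hpe using h1
  refine ⟨fun t => ∑ i ∈ Finset.Icc 1 m, p i t, MemC.sum hp, fun t ht => ?_⟩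
  rw [rlIntegral_sum zero_le_one hs.lt_one hp ht]
  exact Finset.sum_congr rfl fun i hi => hpe i hi t ht

/-- For functions `t^j / j! + I^{α₀} u` the differential equation is an integral equation
for `u`. -/
theorem isSolution_iff {T : ℝ} {m N j : ℕ} {α : ℕ → ℝ} {a : ℕ → ℝ → ℝ} {f u : ℝ → ℝ}
    (hα0 : ∀ i ≤ m, 0 ≤ α i) (hαle : ∀ i ≤ m, α i ≤ α 0) (hN : (N : ℝ) < α 0)
    (hN' : α 0 ≤ (N : ℝ) + 1) (hj : j ≤ N) (hu : MemC 0 T u)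
    (hf : ∀ t ∈ Ioc 0 T, f t = Phi ((j : ℝ) + 1) t + rlIntegral (α 0) u t)
    (h0 : ∀ k ≤ N, iteratedDerivWithin k f (Icc 0 T) 0 = if j = k then 1 else 0) :
    IsSolution T m α a f ↔ ∀ t ∈ Ioo 0 T, u t = -source m α a j t - opL m α a u t := by
  have hc : ∀ i ≤ m, ⌈α i⌉₊ ≤ N + 1 := fun i hi =>
    Nat.ceil_le.2 (by push_cast; exact (hαle i hi).trans hN')
  have h1 := fun i (hi : i ≤ m) => caputo_of_eq_Phi_add_rlIntegral (hα0 i hi) (hαle i hi) hu hf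
    fun k hk => h0 k (Nat.lt_succ_iff.1 (hk.trans_le (hc i hi)))
  have hj' : (j : ℝ) ≤ N := Nat.cast_le.2 hj
  have h2 : ∀ t ∈ Ioo 0 T, caputoDeriv T (α 0) f t = u t := by
    intro t ht
    rw [(h1 0 (Nat.zero_le m)).2 t ht, if_neg (by linarith), sub_self, rlIntegral_zero, zero_add]
  have h3 : ∀ t ∈ Ioo 0 T, ∑ i ∈ Finset.Icc 1 m, a i t * caputoDeriv T (α i) f t =
      source m α a j t + opL m α a u t := by
    intro t ht
    rw [source, opL, ← Finset.sum_add_distrib]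
    refine Finset.sum_congr rfl fun i hi => ?_
    rw [(h1 i (Finset.mem_Icc.1 hi).2).2 t ht, mul_add]
  constructor
  · intro h t ht
    have h4 := h.2 t ht
    rw [h2 t ht, h3 t ht] at h4
    rw [h4, neg_add, sub_eq_add_neg]
  · intro h
    refine ⟨fun i hi => (h1 i hi).1, fun t ht => ?_⟩
    rw [h2 t ht, h3 t ht, h t ht, neg_add, sub_eq_add_neg]

theorem opL_sub {T : ℝ} {m : ℕ} {α : ℕ → ℝ} {a : ℕ → ℝ → ℝ} {u v : ℝ → ℝ}
    (hα : ∀ i ∈ Finset.Icc 1 m, α i < α 0) (hu : MemC 0 T u) (hv : MemC 0 T v)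
    {t : ℝ} (ht : t ∈ Icc 0 T) :
    opL m α a (fun s => u s - v s) t = opL m α a u t - opL m α a v t := by
  rw [opL, opL, opL, ← Finset.sum_sub_distrib]
  refine Finset.sum_congr rfl fun i hi => ?_
  rw [rlIntegral_sub (sub_pos.2 (hα i hi)).le one_pos hu hv ht, mul_sub]

theorem IsVolterraSystem.eqOn_of_integral_equation {γ T : ℝ} {m : ℕ} {α : ℕ → ℝ}
    {a a' : ℕ → ℝ → ℝ} (hs : IsVolterraSystem γ T m α a a') {F u v : ℝ → ℝ}
    (hu : MemC 0 T u) (hv : MemC 0 T v)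
    (hue : ∀ t ∈ Ioo 0 T, u t = -F t - opL m α a u t)
    (hve : ∀ t ∈ Ioo 0 T, v t = -F t - opL m α a v t) : EqOn u v (Ioo 0 T) := by
  intro t ht
  refine sub_eq_zero.1 (hs.eq_zero_of_eq_neg_opL (hu.sub hv) (fun x hx => ?_) ht)
  rw [opL_sub hs.order_lt hu hv ⟨hx.1.le, hx.2.le⟩]
  linarith [hue x hx, hve x hx]

theorem rlIntegral_eq_of_eqOn {b T t : ℝ} {u v : ℝ → ℝ} (hb : 0 < b) (h : EqOn u v (Ioo 0 T))
    (ht : t ∈ Icc 0 T) : rlIntegral b u t = rlIntegral b v t :=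
  rlIntegral_congr hb ht.1 fun _ hs => h ⟨hs.1, hs.2.trans_le ht.2⟩

/-- A function of class `C_γ^{N+1}` with the initial values of `t^j / j!` is
`t^j / j! + I^{N+1-γ} u`. -/
theorem MemCn.exists_eq_Phi_add_rlIntegral {γ T : ℝ} {z : ℝ → ℝ} {N j : ℕ} (hT : 0 < T)
    (hγ0 : 0 < γ) (hγ : γ < 1) (hj : j ≤ N) (hz : MemCn γ T (N + 1) z)
    (h0 : ∀ k ≤ N, iteratedDerivWithin k z (Icc 0 T) 0 = if j = k then 1 else 0) :
    ∃ u, MemC 0 T u ∧ ∀ t ∈ Icc 0 T, z t = Phi ((j : ℝ) + 1) t +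
      rlIntegral ((N : ℝ) + 1 - γ) u t := by
  refine ⟨rlIntegral γ (iteratedDerivWithin (N + 1) z (Icc 0 T)),
    hz.2.2.rlIntegral hγ0.le hγ hT (by linarith), fun t ht => ?_⟩
  have hN : (0 : ℝ) ≤ N := Nat.cast_nonneg N
  rw [hz.eq_Phi_add_rlIntegral hT hγ0.le hγ hj h0 ht,
    rlIntegral_rlIntegral (by linarith) hγ0.le hγ hz.2.2 ht, sub_add_cancel]

theorem IsVolterraSystem.solution_unique {γ T : ℝ} {m N j : ℕ} {α : ℕ → ℝ} {a a' : ℕ → ℝ → ℝ}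
    (hs : IsVolterraSystem γ T m α a a') (hγ0 : 0 < γ) (hα0 : ∀ i ≤ m, 0 ≤ α i)
    (hN : α 0 = (N : ℝ) + 1 - γ) (hj : j ≤ N) {y z : ℝ → ℝ}
    (hy : MemCn γ T (N + 1) y) (hys : IsSolution T m α a y)
    (hy0 : ∀ k ≤ N, iteratedDerivWithin k y (Icc 0 T) 0 = if j = k then 1 else 0)
    (hz : MemCn γ T (N + 1) z) (hzs : IsSolution T m α a z)
    (hz0 : ∀ k ≤ N, iteratedDerivWithin k z (Icc 0 T) 0 = if j = k then 1 else 0) :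
    EqOn z y (Icc 0 T) := by
  have hγ := hs.lt_one
  have hαle : ∀ i ≤ m, α i ≤ α 0 := fun i hi => by
    rcases Nat.eq_zero_or_pos i with rfl | h
    · rfl
    · exact (hs.order_lt i (Finset.mem_Icc.2 ⟨h, hi⟩)).le
  obtain ⟨u, hu, hyu⟩ := hy.exists_eq_Phi_add_rlIntegral hs.pos hγ0 hγ hj hy0
  obtain ⟨v, hv, hzv⟩ := hz.exists_eq_Phi_add_rlIntegral hs.pos hγ0 hγ hj hz0
  rw [← hN] at hyu hzv
  have h1 := (isSolution_iff hα0 hαle (by linarith) (by linarith) hj hu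
    (fun t ht => hyu t ⟨ht.1.le, ht.2⟩) hy0).1 hys
  have h2 := (isSolution_iff hα0 hαle (by linarith) (by linarith) hj hv
    (fun t ht => hzv t ⟨ht.1.le, ht.2⟩) hz0).1 hzs
  have hpos : 0 < α 0 := by
    have : (0 : ℝ) ≤ N := Nat.cast_nonneg N
    linarith
  intro t ht
  rw [hzv t ht, hyu t ht,
    rlIntegral_eq_of_eqOn hpos (hs.eqOn_of_integral_equation hv hu h2 h1) ht]

theorem IsVolterraSystem.exists_solution {γ T : ℝ} {m N j : ℕ} {α : ℕ → ℝ} {a a' : ℕ → ℝ → ℝ}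
    (hs : IsVolterraSystem γ T m α a a') (hγ0 : 0 < γ) (hα0 : ∀ i ≤ m, 0 ≤ α i)
    (hN : α 0 = (N : ℝ) + 1 - γ) (hj : j ≤ N) :
    ∃ y : ℝ → ℝ, MemCn γ T (N + 1) y ∧ IsSolution T m α a y ∧
      (∀ k ≤ N, iteratedDerivWithin k y (Icc 0 T) 0 = if j = k then 1 else 0) ∧
      ((∀ t ∈ Icc 0 T, source m α a j t = 0) → ∀ t ∈ Icc 0 T, y t = Phi ((j : ℝ) + 1) t) ∧
      (∀ t ∈ Icc 0 T, HasSum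
        (fun k => (-1) ^ (k + 1) * rlIntegral (α 0) ((opL m α a)^[k] (source m α a j)) t)
        (y t - Phi ((j : ℝ) + 1) t)) ∧
      ConvergesInCn γ T (N + 1) (fun M t => Phi ((j : ℝ) + 1) t + ∑ k ∈ Finset.range M,
        (-1) ^ (k + 1) * rlIntegral (α 0) ((opL m α a)^[k] (source m α a j)) t) y := by
  have hγ := hs.lt_one
  have hαle : ∀ i ≤ m, α i ≤ α 0 := fun i hi => by
    rcases Nat.eq_zero_or_pos i with rfl | h
    · rfl
    · exact (hs.order_lt i (Finset.mem_Icc.2 ⟨h, hi⟩)).le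
  have hN0 : (0 : ℝ) ≤ N := Nat.cast_nonneg N
  have hpos : 0 < α 0 := by linarith
  have hα1 : α 0 + 1 = (N : ℝ) + 2 - γ := by linarith
  obtain ⟨p, hp, hF⟩ := exists_source_eq_rlIntegral_one hs j
  obtain ⟨C, s, hg, hiter, heq⟩ := hs.exists_series hp hF
  set P : ℝ → ℝ := fun t => ∑' k, s k t with hP
  have hPm : MemC γ T P := hg.memC_tsum
  have hterm : ∀ k, ∀ t ∈ Icc 0 T,
      (-1) ^ (k + 1) * rlIntegral (α 0) ((opL m α a)^[k] (source m α a j)) t =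
        rlIntegral (α 0 + 1) (s k) t := by
    intro k t ht
    rw [← rlIntegral_const_mul, rlIntegral_congr_Icc hpos ht fun x hx =>
      hiter k x ⟨hx.1.le, hx.2⟩, rlIntegral_rlIntegral hpos.le zero_le_one hγ (hg.memC k) ht]
  set u : ℝ → ℝ := rlIntegral 1 P with hu
  have hum : MemC 0 T u := hPm.rlIntegral zero_le_one hγ hs.pos (by linarith)
  set y : ℝ → ℝ := fun t => Phi ((j : ℝ) + 1) t + rlIntegral (α 0 + 1) P t with hy
  have hyu : ∀ t ∈ Icc 0 T, y t = Phi ((j : ℝ) + 1) t + rlIntegral (α 0) u t := fun t ht => by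
    rw [hu, rlIntegral_rlIntegral hpos.le zero_le_one hγ hPm ht]
  obtain ⟨hy1, hy2, -⟩ := memCn_monomial_add_rlIntegral (f := y) hs.pos hγ hj hPm
    fun t _ => by rw [← hα1]
  have hinit : ∀ k ≤ N, iteratedDerivWithin k y (Icc 0 T) 0 = if j = k then 1 else 0 := by
    intro k hk
    have hk' : (k : ℝ) ≤ N := Nat.cast_le.2 hk
    rw [hy2 k hk (left_mem_Icc.2 hs.pos.le)]
    simp only
    rw [monomialDeriv_at_zero, rlIntegral_at_zero (by linarith), add_zero]
  refine ⟨y, hy1, ?_, hinit, fun hzero t ht => ?_, fun t ht => ?_, ?_⟩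
  · exact (isSolution_iff hα0 hαle (by linarith) (by linarith) hj hum
      (fun t ht => hyu t ⟨ht.1.le, ht.2⟩) hinit).2 fun t ht => heq t ⟨ht.1.le, ht.2.le⟩
  · have h1 : EqOn u (fun _ => 0) (Ioo 0 T) := fun x hx =>
      hs.eq_zero_of_eq_neg_opL hum (fun x hx => by
        have h2 := heq x ⟨hx.1.le, hx.2.le⟩
        rw [hzero x ⟨hx.1.le, hx.2.le⟩, neg_zero, zero_sub] at h2
        exact h2) hx
    rw [hyu t ht, rlIntegral_eq_of_eqOn hpos h1 ht, rlIntegral_zero_fun, add_zero]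
  · have h1 := hg.hasSum_rlIntegral (b := α 0 + 1) (by linarith) ht
    simp only [hterm _ t ht]
    rw [hy, add_sub_cancel_left]
    exact h1
  · refine hg.convergesInCn hγ0 hj (fun t _ => by rw [← hα1]) fun M t ht => ?_
    simp only [hterm _ t ht]
    rw [← hα1, rlIntegral_sum (by linarith) hγ (fun k _ => hg.memC k) ht]

theorem source_eq_zero {m j : ℕ} {α : ℕ → ℝ} {a : ℕ → ℝ → ℝ} (hα0 : ∀ i ≤ m, 0 ≤ α i)
    (hH : H m α j = ∅) (t : ℝ) : source m α a j t = 0 := by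
  refine Finset.sum_eq_zero fun i hi => ?_
  rw [Finset.mem_Icc] at hi
  rw [if_neg, mul_zero]
  intro h
  exact (hH ▸ (⟨hi.1, hi.2, hα0 i hi.2, h⟩ : i ∈ H m α j) : i ∈ (∅ : Set ℕ))

theorem source_eq_sum_Icc {m j : ℕ} {α : ℕ → ℝ} {a : ℕ → ℝ → ℝ} (hα0 : ∀ i ≤ m, 0 ≤ α i)
    (hα : ∀ i k, i < k → k ≤ m → α k < α i) (hH : (H m α j).Nonempty) :
    source m α a j = fun t => ∑ i ∈ Finset.Icc (h m α j) m, a i t * Phi ((j : ℝ) + 1 - α i) t := by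
  ext t
  obtain ⟨hh1, hh2, -, hh3⟩ : h m α j ∈ H m α j := Nat.sInf_mem hH
  have h1 : Finset.Icc (h m α j) m = (Finset.Icc 1 m).filter fun i => α i ≤ j := by
    ext i
    simp only [Finset.mem_filter, Finset.mem_Icc]
    constructor
    · rintro ⟨h2, h3⟩
      refine ⟨⟨hh1.trans h2, h3⟩, ?_⟩
      rcases h2.eq_or_lt with h4 | h4
      · rwa [← h4]
      · exact (hα _ _ h4 h3).le.trans hh3
    · rintro ⟨⟨h2, h3⟩, h4⟩
      exact ⟨Nat.sInf_le ⟨h2, h3, hα0 i h3, h4⟩, h3⟩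
  rw [h1, Finset.sum_filter]
  refine Finset.sum_congr rfl fun i _ => ?_
  rw [mul_ite, mul_zero]

theorem H_mono (m : ℕ) (α : ℕ → ℝ) {j k : ℕ} (hjk : j ≤ k) : H m α j ⊆ H m α k :=
  fun _ hi => ⟨hi.1, hi.2.1, hi.2.2.1, hi.2.2.2.trans (Nat.cast_le.2 hjk)⟩

end CaputoODE

end

theorem theorem3 (T : ℝ) (hT : 0 < T) (m : ℕ) (α : ℕ → ℝ) (n : ℕ → ℕ) (a : ℕ → ℝ → ℝ)
    (γ : ℝ) (j₀ : ℕ)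
    (hα : ∀ i k, i < k → k ≤ m → α k < α i)
    (hα0 : ∀ i ≤ m, 0 ≤ α i)
    (hn : ∀ i ≤ m, (n i : ℝ) - 1 < α i ∧ α i ≤ (n i : ℝ))
    (hγ : γ = (n 0 : ℝ) - α 0) (hγ0 : 0 < γ) (hγ1 : γ < 1)
    (hn01 : n 0 = n 1)
    (ha : ∀ i, 1 ≤ i → i ≤ m → CaputoODE.MemCn γ T 1 (a i))
    (haD : ∀ i, 1 ≤ i → i ≤ m →
      CaputoODE.RLDifferentiable T ((n 0 : ℝ) - α 0) (a i) ∧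
      ∃ g : ℝ → ℝ, ContinuousOn g (Set.Icc 0 T) ∧
        ∀ t ∈ Set.Ioo 0 T, CaputoODE.rlDeriv ((n 0 : ℝ) - α 0) (a i) t = g t)
    (hn2 : 2 ≤ n 0) (hj₀ : j₀ ≤ n 0 - 2)
    (hH : CaputoODE.H m α j₀ = ∅) (hH' : (CaputoODE.H m α (j₀ + 1)).Nonempty) :
    ∃ y : Fin (n 0) → ℝ → ℝ,
      CaputoODE.IsCanonicalSystem γ T m α a (n 0) y ∧
      (∀ z : Fin (n 0) → ℝ → ℝ, CaputoODE.IsCanonicalSystem γ T m α a (n 0) z →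
        ∀ j, Set.EqOn (z j) (y j) (Set.Icc 0 T)) ∧
      (∀ j : Fin (n 0), (j : ℕ) ≤ j₀ →
        ∀ t ∈ Set.Icc 0 T, y j t = CaputoODE.Phi ((j : ℝ) + 1) t) ∧
      (∀ j : Fin (n 0), j₀ < (j : ℕ) →
        (∀ t ∈ Set.Icc 0 T, HasSum (fun k : ℕ => CaputoODE.seriesTerm m α a j k t)
          (y j t - CaputoODE.Phi ((j : ℝ) + 1) t)) ∧
        CaputoODE.ConvergesInCn γ T (n 0)
          (fun N t => CaputoODE.Phi ((j : ℝ) + 1) t +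
            ∑ k ∈ Finset.range N, CaputoODE.seriesTerm m α a j k t)
          (y j)) := by
  obtain ⟨N, hN⟩ : ∃ N, n 0 = N + 1 := ⟨n 0 - 1, by omega⟩
  have hα0N : α 0 = (N : ℝ) + 1 - γ := by
    rw [hγ, hN]
    push_cast
    ring
  rw [← hγ] at haD
  have hs : CaputoODE.IsVolterraSystem γ T m α a
      (fun i => iteratedDerivWithin 1 (a i) (Set.Icc 0 T)) := by
    refine ⟨hT, hγ1, fun i hi => ?_, fun i hi => ?_, fun i hi t ht => ?_⟩ <;>
      rw [Finset.mem_Icc] at hi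
    · exact hα 0 i hi.1 hi.2
    · exact (ha i hi.1 hi.2).2.2
    · obtain ⟨-, g, hg, hD⟩ := haD i hi.1 hi.2
      rw [(ha i hi.1 hi.2).one_eq_add_rlIntegral hγ1 ht,
        (ha i hi.1 hi.2).one_eq_zero_of_rlDeriv hT hγ0 hγ1 hg hD, zero_add]
  clear hn hn01 hγ haD
  generalize n 0 = n₀ at *
  subst hN
  have hex := fun j : Fin (N + 1) => hs.exists_solution hγ0 hα0 hα0N (Nat.lt_succ_iff.1 j.2)
  choose y hy1 hy2 hy3 hy4 hy5 hy6 using hex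
  refine ⟨y, fun j => ⟨hy1 j, hy2 j, fun k => ?_⟩, fun z hz j => ?_, fun j hj => ?_, fun j hj => ?_⟩
  · rw [hy3 j k (Nat.lt_succ_iff.1 k.2)]
    simp only [Fin.ext_iff]
  · obtain ⟨hz1, hz2, hz3⟩ := hz j
    refine hs.solution_unique hγ0 hα0 hα0N (Nat.lt_succ_iff.1 j.2) (hy1 j) (hy2 j) (hy3 j)
      hz1 hz2 fun k hk => ?_
    have h1 := hz3 ⟨k, Nat.lt_succ_iff.2 hk⟩
    simpa only [Fin.ext_iff] using h1
  · exact hy4 j fun t _ => CaputoODE.source_eq_zero hα0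
      (Set.subset_eq_empty (CaputoODE.H_mono m α hj) hH) t
  · have h1 := CaputoODE.source_eq_sum_Icc (a := a) hα0 hα
      (hH'.mono (CaputoODE.H_mono m α (Nat.succ_le_of_lt hj)))
    have h2 := hy5 j
    have h3 := hy6 j
    rw [h1] at h2 h3
    exact ⟨h2, h3⟩
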